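/- **The system.** Let $1\le D<N$ be integers, let $\lambda>0$, and let $G$ be any probability distribution on $(0,\infty)$. Consider $N$ parallel unit-speed servers. Tasks arrive as a Poisson process of rate $\lambda N$ and have i.i.d. service times with law $G$, independent of the arrival process. At each arrival, $D$ distinct servers are sampled uniformly at random, independently of everything before, and the task immediately joins a sampled server with the fewest tasks (ties are broken uniformly at random). All servers use the same work-conserving service discipline: a rule that determines the service given to each task from the tasks that have arrived at that server so far (their arrival times, service times, and independent auxiliary random marks), without anticipating the future, such that a server works at total speed at most $1$, and at speed exactly $1$ whenever a task is present there. A task leaves once it has received its service time. For $\xi\in\mathbb Z_+^N$ let $X_t(i)$ be the number of tasks at server $i$ at time $t$, when exactly $\xi(i)$ tasks are present at each server $i$ at time $0$. The remaining service times (and auxiliary marks) of these initial tasks may have any law on positive requirements (for instance i.i.d. with law $G$, or deterministic), but are independent between servers and independent of the arriving tasks. Put $$m_k(t)=\frac1N\sum_{i=1}^N \mathbf 1_{\{X_t(i)=k\}},\qquad k\in\mathbb Z_+ .$$ **Proposition 2.1.** For all such $N,D,\lambda,G$, every such discipline, and all $t\ge0$ and $k,l\in\mathbb Z_+$, the $X_t(i)$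 are random variables and $$\sup_{\xi\in\mathbb Z_+^N}\Big|\mathbb E_\xi[m_k(t)m_l(t)]-\mathbb E_\xi[m_k(t)]\,\mathbb E_\xi[m_l(t)]\Big|\le B_{N,D}(t),$$ $$B_{N,D}(t)=\frac1N+\frac{2(3/2)^DN}{N-D}\left[N\ln\Big(\frac{N+u_N(t)-1}{N}\Big)-\frac{(N-1)(u_N(t)-1)}{N+u_N(t)-1}\right],$$ where $u_N(t)=\exp\Big(\dfrac{2^{D-1}\lambda DN}{N-D}\,t\Big)$. In this bound $N$ and $D$ are arbitrary with $1\le D<N$, so $D$ may depend on $N$. Moreover, for every fixed $D\ge1$, $\lambda>0$ and $t\ge0$, $B_{N,D}(t)\to0$ as $N\to\infty$. -/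

import Mathlib

open MeasureTheory ProbabilityTheory Filter Topology
open scoped Classical

/-- A job as seen by the server that receives it: `(arrival time, (service requirement, seed))`.
The seed is auxiliary randomness or information which a discipline may use (random order of
service, elapsed service of a job already present at time `0`, ...). -/
abbrev Job : Type := ℝ × ℝ × ℝ

def Job.arrival (a : Job) : ℝ := a.1

def Job.size (a : Job) : ℝ := a.2.1

/-- The streams of jobs a single server can be offered: jobs are numbered in order of arrival,
arrive at nonnegative times (time `0` for the jobs initially present), and have positive size. -/
structure IsJobStream {n : ℕ} (x : Fin n → Job) : Prop where
  mono : Monotone fun j => Job.arrival (x j)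
  arrival_nonneg : ∀ j, 0 ≤ Job.arrival (x j)
  size_pos : ∀ j, 0 < Job.size (x j)

/-- A work-conserving service discipline of a single server of unit speed.
`service x j t` is the cumulative amount of service which job `j` of the stream `x` has received
by time `t`. The job leaves as soon as this reaches its size. -/
structure WorkConservingDiscipline where
  service : {n : ℕ} → (Fin n → Job) → Fin n → ℝ → ℝ
  /-- No service before arrival. -/
  service_eq_zero : ∀ {n : ℕ} (x : Fin n → Job), IsJobStream x → ∀ (j : Fin n) (t : ℝ),
    t ≤ Job.arrival (x j) → service x j t = 0
  /-- Service given is never taken back. -/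
  service_mono : ∀ {n : ℕ} (x : Fin n → Job), IsJobStream x → ∀ j : Fin n,
    Monotone (service x j)
  /-- A job is never served beyond its size. -/
  service_le_size : ∀ {n : ℕ} (x : Fin n → Job), IsJobStream x → ∀ (j : Fin n) (t : ℝ),
    service x j t ≤ Job.size (x j)
  /-- The server works at most at unit speed. -/
  work_le : ∀ {n : ℕ} (x : Fin n → Job), IsJobStream x → ∀ s t : ℝ, s ≤ t →
    ∑ j, (service x j t - service x j s) ≤ t - s
  /-- Work conservation: the server works at full speed as long as some job is present. -/
  work_eq : ∀ {n : ℕ} (x : Fin n → Job), IsJobStream x → ∀ s t : ℝ, s ≤ t →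
    (∀ r ∈ Set.Ico s t, ∃ j, Job.arrival (x j) ≤ r ∧ service x j r < Job.size (x j)) →
    ∑ j, (service x j t - service x j s) = t - s
  /-- The discipline is non-anticipating: a later arrival does not influence the past. -/
  nonanticipating : ∀ {n : ℕ} (x : Fin n → Job) (a : Job),
    IsJobStream (Fin.snoc x a : Fin (n + 1) → Job) → ∀ (j : Fin n) (t : ℝ),
    t ≤ Job.arrival a →
    service (Fin.snoc x a : Fin (n + 1) → Job) j.castSucc t = service x j t
  measurable_service : ∀ {n : ℕ} (j : Fin n),
    Measurable fun p : (Fin n → Job) × ℝ => service p.1 j p.2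

/-- The number of jobs present at time `t` at a server that is offered the stream `x`. -/
noncomputable def WorkConservingDiscipline.numJobs (disc : WorkConservingDiscipline) {n : ℕ}
    (x : Fin n → Job) (t : ℝ) : ℕ :=
  (Finset.univ.filter fun j : Fin n =>
    Job.arrival (x j) ≤ t ∧ disc.service x j t < Job.size (x j)).card

/-- Join the shortest queue: `e 0, e 1, ...` are the sampled servers in the order in which they
are drawn, `q` the queue lengths; the task joins server `i` if `i` is the first drawn among the
sampled servers with the shortest queue. For an `e` that is uniform among the injective ones, the
sampled set is uniform, and ties are broken uniformly. -/
def JoinsServer {N D : ℕ} (q : Fin N → ℕ) (e : Fin D → Fin N) (i : Fin N) : Prop :=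
  ∃ r : Fin D, e r = i ∧ (∀ r', q (e r) ≤ q (e r')) ∧ ∀ r', r' < r → q (e r) < q (e r')

/-- The random input of the system with `N` servers, `JSQ(D)` routing, total arrival rate
`lam * N` and service time distribution `G`.

`mark n` is the quadruple (time between the arrivals `n - 1` and `n`, ordered sample of `D`
distinct servers, service time, seed) of the `n`-th arriving task, `n = 0, 1, ...`. These
quadruples are i.i.d. with independent components: exponential with parameter `lam * N` (so that
arrivals form a Poisson process), uniform among all ordered samples without replacement, `G`, and
uniform on `[0, 1]`.

`initial i m` is the pair (remaining service requirement, seed) of the `m`-th task that is present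
at server `i` at time `0`. These data may have any law (for instance i.i.d. requirements with law
`G`, or deterministic ones) with positive requirements, but are independent for different servers
and of the arriving tasks. -/
structure JSQInput {Ω : Type*} [MeasurableSpace Ω] (P : Measure Ω) (N D : ℕ) (lam : ℝ)
    (G : Measure ℝ) where
  mark : ℕ → Ω → ℝ × (Fin D → Fin N) × ℝ × ℝ
  initial : Fin N → Ω → ℕ → ℝ × ℝ
  measurable_mark : ∀ n, Measurable (mark n)
  measurable_initial : ∀ i, Measurable (initial i)
  map_mark : ∀ n, P.map (mark n) =
    (expMeasure (lam * N)).prod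
      ((uniformOn {e : Fin D → Fin N | Function.Injective e}).prod
        (G.prod (volume.restrict (Set.Icc (0 : ℝ) 1))))
  iIndepFun_mark : iIndepFun mark P
  iIndepFun_initial : iIndepFun initial P
  indepFun_mark_initial : IndepFun (fun ω n => mark n ω) (fun ω i => initial i ω) P
  initial_pos : ∀ i m, ∀ᵐ ω ∂P, 0 < (initial i ω m).1

namespace JSQInput

variable {Ω : Type*} [MeasurableSpace Ω] {P : Measure Ω} {N D : ℕ} {lam : ℝ} {G : Measure ℝ}

/-- The arrival time of the `n`-th task, `n = 0, 1, ...`. -/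
noncomputable def arrivalTime (S : JSQInput P N D lam G) (n : ℕ) (ω : Ω) : ℝ :=
  ∑ m ∈ Finset.range (n + 1), (S.mark m ω).1

/-- The number of tasks arriving in `[0, t]` (almost surely finite). -/
noncomputable def numArrivals (S : JSQInput P N D lam G) (t : ℝ) (ω : Ω) : ℕ :=
  {n : ℕ | S.arrivalTime n ω ≤ t}.ncard

/-- `jobs disc ξ ω n i` is the list of all jobs offered so far to server `i` (the `ξ i` initial
ones first, finished ones included) after the first `n` arriving tasks have been routed. -/
noncomputable def jobs (S : JSQInput P N D lam G) (disc : WorkConservingDiscipline)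
    (ξ : Fin N → ℕ) (ω : Ω) : ℕ → Fin N → List Job
  | 0 => fun i => (List.range (ξ i)).map fun m => (0, S.initial i ω m)
  | n + 1 => fun i =>
      if JoinsServer (fun i' => disc.numJobs (jobs S disc ξ ω n i').get (S.arrivalTime n ω))
          (S.mark n ω).2.1 i
      then jobs S disc ξ ω n i ++ [(S.arrivalTime n ω, (S.mark n ω).2.2)]
      else jobs S disc ξ ω n i

/-- The queue length process: `queueLength disc ξ t ω i` is the number of tasks at server `i` at
time `t`, when the system starts in the configuration `ξ`. -/
noncomputable def queueLength (S : JSQInput P N D lam G) (disc : WorkConservingDiscipline)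
    (ξ : Fin N → ℕ) (t : ℝ) (ω : Ω) (i : Fin N) : ℕ :=
  disc.numJobs (S.jobs disc ξ ω (S.numArrivals t ω) i).get t

end JSQInput

/-- The proportion of the `N` servers which have exactly `k` tasks in the configuration `x`. -/
noncomputable def empiricalMeasure {N : ℕ} (x : Fin N → ℕ) (k : ℕ) : ℝ :=
  (∑ i, if x i = k then (1 : ℝ) else 0) / N

noncomputable def uN (N D : ℕ) (lam t : ℝ) : ℝ :=
  Real.exp (2 ^ (D - 1) * lam * D * N / ((N : ℝ) - D) * t)

noncomputable def chaosBound (N D : ℕ) (lam t : ℝ) : ℝ :=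
  1 / N + 2 * (3 / 2) ^ D * N / ((N : ℝ) - D) *
    (N * Real.log ((N + uN N D lam t - 1) / N)
      - ((N : ℝ) - 1) * (uN N D lam t - 1) / (N + uN N D lam t - 1))

/-! Since |Cov(X,Y)| ≤ (Var X + Var Y)/2, it suffices to bound the variance of a single proportion
m_k(t). Describe each server by the jobs offered to it so far. Whatever the discipline, this state
changes only at arrivals, and the queue length is a function of the state and of time. The system is
thus a jump chain driven by i.i.d. marks and stopped at the horizon t. Let V(s,q) be the expected
terminal proportion from state q at time s (`exists_jump_value`).

Influence of a perturbation: run two copies from q and q' with the same arrivals, and let m be the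
number of servers where they differ. An arrival whose sample avoids these servers creates no new
difference. In general the number of new differences is at most the number of ordered sampled pairs
with first member outside and second inside the differing set (`card_differing_routeJob_le`), whose
mean is D(D-1)m(N-m)/(N(N-1)). Arrivals have rate λN, so m is governed by the logistic equation y' =
cy(1-y/N). Its flow y_m is concave in the initial value m, whence |V(s,q)-V(s,q')| ≤ y_m(t-s)/N
(`abs_sub_value_le_logistic`).

Variance: V along the chain is a martingale ending at m_k(t). An arrival at time r alters at most
one server, so the squared jump is at most (y_1(t-r)/N)²; at rate λN the jumps contribute at most
(λ/N)∫y_1² (`iterate_jumpOp_sq_le`). The initial data of the N servers are independent, and changing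
one of them moves V(0,·) by at most y_1(t)/N, so they contribute at most y_1(t)²/N
(`integral_pi_sq_le_of_bounded_differences`). Both contributions are explicit, and
`logistic_sq_add_energy_le_chaosBound` compares their sum with `chaosBound`. -/

/-! ### Exponential clocks and first-jump equations. -/

lemma integral_expMeasure {θ : ℝ} (hθ : 0 < θ) (f : ℝ → ℝ) :
    ∫ τ, f τ ∂(expMeasure θ) = ∫ τ in Set.Ioi 0, θ * Real.exp (-(θ * τ)) * f τ := by
  have h : expMeasure θ = (volume.restrict (Set.Ioi (0 : ℝ))).withDensity
      (fun τ => ENNReal.ofReal (θ * Real.exp (-(θ * τ)))) := by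
    change volume.withDensity (gammaPDF 1 θ) = _
    rw [← withDensity_indicator measurableSet_Ioi]
    apply withDensity_congr_ae
    have : ∀ᵐ τ : ℝ ∂volume, τ ≠ 0 := by simp [ae_iff]
    filter_upwards [this] with τ hτ
    change exponentialPDF θ τ = _
    rw [exponentialPDF_eq]
    rcases lt_or_gt_of_ne hτ with h | h
    · simp [h.le, not_le.2 h]
    · simp [h, h.le]
  rw [h, integral_withDensity_eq_integral_toReal_smul (by fun_prop) (by simp)]
  refine setIntegral_congr_fun measurableSet_Ioi fun τ _ => ?_
  simp only [smul_eq_mul]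
  rw [ENNReal.toReal_ofReal (by positivity)]

/-- Splitting at the horizon: the clock rings at r ≤ t with density θe^{-θ(r-s)}, and survives t
with probability e^{-θ(t-s)}. -/
lemma integral_expMeasure_shift {θ : ℝ} (hθ : 0 < θ) {s t : ℝ} (hst : s ≤ t) (φ : ℝ → ℝ) (c : ℝ)
    (hφ : IntervalIntegrable φ volume s t) :
    ∫ τ, (if s + τ ≤ t then φ (s + τ) else c) ∂(expMeasure θ) =
      (∫ r in s..t, θ * Real.exp (-(θ * (r - s))) * φ r) + Real.exp (-(θ * (t - s))) * c := by
  rw [integral_expMeasure hθ]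
  have h0 : (0 : ℝ) ≤ t - s := sub_nonneg.2 hst
  have hi : IntegrableOn (fun τ => θ * Real.exp (-(θ * τ))) (Set.Ioi (t - s)) := by
    have := (exp_neg_integrableOn_Ioi (t - s) hθ).const_mul θ
    simpa only [neg_mul, IntegrableOn] using this
  have hφ' : IntervalIntegrable (fun r => θ * Real.exp (-(θ * (r - s))) * φ r) volume s t :=
    hφ.continuousOn_mul (by fun_prop)
  have hsub : ∫ r in s..t, θ * Real.exp (-(θ * (r - s))) * φ r =
      ∫ τ in (0 : ℝ)..(t - s), θ * Real.exp (-(θ * τ)) * φ (s + τ) := by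
    have := intervalIntegral.integral_comp_add_left
      (fun r => θ * Real.exp (-(θ * (r - s))) * φ r) (a := 0) (b := t - s) s
    simp only [add_sub_cancel_left, add_zero, add_sub_cancel] at this
    exact this.symm
  have hI1 : IntegrableOn (fun τ => θ * Real.exp (-(θ * τ)) * φ (s + τ)) (Set.Ioc 0 (t - s)) := by
    rw [← intervalIntegrable_iff_integrableOn_Ioc_of_le h0]
    have := hφ'.comp_add_left s
    simpa using this
  have hsplit : Set.Ioi (0 : ℝ) = Set.Ioc 0 (t - s) ∪ Set.Ioi (t - s) :=
    (Set.Ioc_union_Ioi_eq_Ioi h0).symm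
  have e1 : Set.EqOn (fun τ => θ * Real.exp (-(θ * τ)) * (if s + τ ≤ t then φ (s + τ) else c))
      (fun τ => θ * Real.exp (-(θ * τ)) * φ (s + τ)) (Set.Ioc 0 (t - s)) := by
    intro τ hτ
    have : s + τ ≤ t := by linarith [hτ.2]
    simp [this]
  have e2 : Set.EqOn (fun τ => θ * Real.exp (-(θ * τ)) * (if s + τ ≤ t then φ (s + τ) else c))
      (fun τ => θ * Real.exp (-(θ * τ)) * c) (Set.Ioi (t - s)) := by
    intro τ hτ
    have : ¬ s + τ ≤ t := by have := Set.mem_Ioi.1 hτ; linarith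
    simp [this]
  rw [hsplit, setIntegral_union (Set.Ioc_disjoint_Ioi le_rfl) measurableSet_Ioi
      (hI1.congr_fun e1.symm measurableSet_Ioc)
      (IntegrableOn.congr_fun (hi.mul_const c) e2.symm measurableSet_Ioi),
    setIntegral_congr_fun measurableSet_Ioc e1, setIntegral_congr_fun measurableSet_Ioi e2, hsub,
    intervalIntegral.integral_of_le h0, integral_mul_const, integral_const_mul]
  congr 2
  have := integral_exp_mul_Ioi (a := -θ) (by linarith) (t - s)
  simp only [neg_mul] at this
  rw [this]
  field_simp

/-- The integrand is the derivative of -e^{-θ(r-s)}φ(t-r). This puts a function of the time to go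
into first-jump form, so that differential inequalities can be compared with the transition
operator. -/
lemma renewal_integral {θ : ℝ} (hθ : 0 < θ) (s t : ℝ) {φ φ' : ℝ → ℝ}
    (hφ : ∀ τ, HasDerivAt φ (φ' τ) τ) (hφ' : Continuous φ') :
    (∫ r in s..t, θ * Real.exp (-(θ * (r - s))) * (φ (t - r) + φ' (t - r) / θ)) +
      Real.exp (-(θ * (t - s))) * φ 0 = φ (t - s) := by
  have hc : Continuous φ := continuous_iff_continuousAt.2 fun τ => (hφ τ).continuousAt
  have hd : ∀ r ∈ Set.uIcc s t, HasDerivAt (fun r => -(Real.exp (-(θ * (r - s))) * φ (t - r)))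
      (θ * Real.exp (-(θ * (r - s))) * (φ (t - r) + φ' (t - r) / θ)) r := by
    intro r _
    have h1 : HasDerivAt (fun r => Real.exp (-(θ * (r - s))))
        (Real.exp (-(θ * (r - s))) * (-(θ * 1))) r :=
      ((((hasDerivAt_id r).sub_const s).const_mul θ).neg).exp
    have h2 : HasDerivAt (fun r => φ (t - r)) (φ' (t - r) * (-1)) r :=
      (hφ (t - r)).comp r ((hasDerivAt_id r).const_sub t)
    refine (h1.mul h2).neg.congr_deriv ?_
    field_simp
    ring
  rw [intervalIntegral.integral_eq_sub_of_hasDerivAt hd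
    (Continuous.intervalIntegrable (by fun_prop) _ _)]
  simp

/-- The equation for v says v' = θ(v - a) almost everywhere, and the integrand is, up to the factor
e^{θs}, the derivative of e^{-θr}v(r)². As a is only locally integrable, the fundamental theorem is
applied in its absolutely continuous form. -/
lemma jump_variance_identity {θ : ℝ} {s t : ℝ} (hst : s ≤ t) (F : ℝ) (a v : ℝ → ℝ)
    (ha : ∀ x y : ℝ, IntervalIntegrable a volume x y)
    (hv : ∀ r ∈ Set.Icc s t, v r = (∫ x in r..t, θ * Real.exp (-(θ * (x - r))) * a x)
      + Real.exp (-(θ * (t - r))) * F) :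
    Real.exp (-(θ * (t - s))) * F ^ 2 - v s ^ 2 =
      ∫ r in s..t, θ * Real.exp (-(θ * (r - s))) * (v r ^ 2 - 2 * a r * v r) := by
  set α : ℝ → ℝ := fun x => θ * Real.exp (-(θ * x)) * a x with hα
  have hαi : ∀ x y : ℝ, IntervalIntegrable α volume x y := fun x y =>
    (ha x y).continuousOn_mul (by fun_prop)
  -- A(r) = e^{-θr}v(r) has derivative -α, and e^{θr}A² = e^{-θr}v².
  set A : ℝ → ℝ := fun r => Real.exp (-(θ * t)) * F - ∫ x in t..r, α x with hA
  have hvA : ∀ r ∈ Set.Icc s t, v r = Real.exp (θ * r) * A r := by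
    intro r hr
    rw [hv r hr, hA]
    simp only
    rw [intervalIntegral.integral_symm r t, sub_neg_eq_add, mul_add,
      ← intervalIntegral.integral_const_mul, ← mul_assoc, ← Real.exp_add, add_comm]
    congr 1
    · congr 2; ring
    · refine intervalIntegral.integral_congr fun x _ => ?_
      simp only [hα]
      rw [show -(θ * (x - r)) = θ * r + -(θ * x) by ring, Real.exp_add]
      ring
  have hAac : AbsolutelyContinuousOnInterval A s t := by
    have h1 := (hαi s t).absolutelyContinuousOnInterval_intervalIntegral (c := t) (by simp)
    have h2 : AbsolutelyContinuousOnInterval (fun _ : ℝ => Real.exp (-(θ * t)) * F) s t :=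
      (LipschitzWith.const _).lipschitzOnWith.absolutelyContinuousOnInterval (K := 0)
    exact h2.sub h1
  have hE : AbsolutelyContinuousOnInterval (fun r : ℝ => Real.exp (θ * r)) s t :=
    ContDiffOn.absolutelyContinuousOnInterval (by fun_prop)
  have hw := (hE.mul (hAac.mul hAac)).integral_deriv_eq_sub
  have hder : ∀ᵐ r ∂volume, r ∈ Set.uIcc s t → HasDerivAt A (-(α r)) r := by
    filter_upwards [(hαi s t).ae_hasDerivAt_integral] with r hr hmem
    simpa using (hr hmem t (by simp)).const_sub (Real.exp (-(θ * t)) * F)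
  have hae : ∀ᵐ r ∂volume, r ∈ Set.uIoc s t →
      deriv ((fun r : ℝ => Real.exp (θ * r)) * (A * A)) r =
        Real.exp (-(θ * s)) * (θ * Real.exp (-(θ * (r - s))) * (v r ^ 2 - 2 * a r * v r)) := by
    filter_upwards [hder] with r hr hmem
    have hmem' : r ∈ Set.uIcc s t := Set.uIoc_subset_uIcc hmem
    have hd := hr hmem'
    have h1 : HasDerivAt (fun r => Real.exp (θ * r)) (Real.exp (θ * r) * (θ * 1)) r :=
      ((hasDerivAt_id r).const_mul θ).exp
    rw [(h1.mul (hd.mul hd)).deriv, hvA r (by rwa [Set.uIcc_of_le hst] at hmem'), mul_left_comm,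
      ← mul_assoc (Real.exp (-(θ * s))), ← mul_assoc θ, mul_left_comm _ θ, ← Real.exp_add,
      show -(θ * s) + -(θ * (r - s)) = -(θ * r) by ring]
    simp only [hα, Pi.mul_apply]
    have hee : Real.exp (-(θ * r)) * Real.exp (θ * r) = 1 := by
      rw [← Real.exp_add]; simp
    generalize Real.exp (-(θ * r)) = y at *
    generalize Real.exp (θ * r) = x at *
    generalize A r = A at *
    linear_combination (-(θ * x * A ^ 2)) * hee
  rw [intervalIntegral.integral_congr_ae hae, intervalIntegral.integral_const_mul] at hw
  have hvs := hvA s (Set.left_mem_Icc.2 hst)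
  have hAt : A t = Real.exp (-(θ * t)) * F := by simp [hA]
  simp only [Pi.mul_apply, hAt] at hw
  have e1 : Real.exp (θ * s) * Real.exp (-(θ * s)) = 1 := by rw [← Real.exp_add]; simp
  have e2 : Real.exp (θ * t) * Real.exp (-(θ * t)) = 1 := by rw [← Real.exp_add]; simp
  have e3 : Real.exp (-(θ * (t - s))) = Real.exp (θ * s) * Real.exp (-(θ * t)) := by
    rw [← Real.exp_add]; congr 1; ring
  rw [hvs, e3]
  generalize (∫ r in s..t, θ * Real.exp (-(θ * (r - s))) * (v r ^ 2 - 2 * a r * v r)) = J at *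
  linear_combination (-Real.exp (θ * s)) * hw + J * e1
    - Real.exp (θ * s) * Real.exp (-(θ * t)) * F ^ 2 * e2

/-! ### The jump chain with a horizon and its value function. -/

/-- One step of a jump chain in continuous time with horizon `t`: from `(s, q)` with `s ≤ t`, the
clock advances by `m.1`, and a jump with mark `m.2` is performed if the horizon is not passed.
Beyond the horizon the chain is frozen. -/
noncomputable def jumpStep {Q Z : Type*} (ρ : Q → ℝ → Z → Q) (t : ℝ) (σ : ℝ × Q) (m : ℝ × Z) :
    ℝ × Q :=
  if σ.1 ≤ t then (σ.1 + m.1, if σ.1 + m.1 ≤ t then ρ σ.2 (σ.1 + m.1) m.2 else σ.2) else σ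

/-- The transition operator of the jump chain. -/
noncomputable def jumpOp {Q Z : Type*} [MeasurableSpace Z] (ρ : Q → ℝ → Z → Q) (t : ℝ)
    (μ : Measure (ℝ × Z)) (f : ℝ × Q → ℝ) (σ : ℝ × Q) : ℝ :=
  ∫ m, f (jumpStep ρ t σ m) ∂μ

set_option linter.unusedSectionVars false

section JumpChain

variable {Q Z : Type*} [MeasurableSpace Q] [MeasurableSpace Z] {ρ : Q → ℝ → Z → Q} {t : ℝ}

lemma iterate_succ_jumpOp (μ : Measure (ℝ × Z)) (f : ℝ × Q → ℝ) (n : ℕ) (σ : ℝ × Q) :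
    (jumpOp ρ t μ)^[n + 1] f σ = ∫ m, (jumpOp ρ t μ)^[n] f (jumpStep ρ t σ m) ∂μ := by
  rw [Function.iterate_succ_apply']; rfl

lemma measurable_jumpStep (hρ : Measurable fun p : Q × ℝ × Z => ρ p.1 p.2.1 p.2.2) :
    Measurable fun p : (ℝ × Q) × (ℝ × Z) => jumpStep ρ t p.1 p.2 := by
  unfold jumpStep
  have hs : Measurable fun p : (ℝ × Q) × (ℝ × Z) => p.1.1 + p.2.1 := by fun_prop
  refine Measurable.ite (measurableSet_le (by fun_prop) measurable_const) ?_ (by fun_prop)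
  refine hs.prodMk (Measurable.ite (measurableSet_le hs measurable_const) ?_ (by fun_prop))
  exact hρ.comp (measurable_fst.snd.prodMk (hs.prodMk measurable_snd.snd))

lemma measurable_jumpStep_right (hρ : Measurable fun p : Q × ℝ × Z => ρ p.1 p.2.1 p.2.2)
    (σ : ℝ × Q) : Measurable (jumpStep ρ t σ) :=
  (measurable_jumpStep hρ).comp measurable_prodMk_left

lemma measurable_jumpOp (hρ : Measurable fun p : Q × ℝ × Z => ρ p.1 p.2.1 p.2.2)
    (μ : Measure (ℝ × Z)) [SFinite μ] {f : ℝ × Q → ℝ} (hf : Measurable f) :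
    Measurable (jumpOp ρ t μ f) :=
  (StronglyMeasurable.integral_prod_right'
    (hf.comp (measurable_jumpStep (t := t) hρ)).stronglyMeasurable).measurable

lemma integrable_comp_jumpStep (hρ : Measurable fun p : Q × ℝ × Z => ρ p.1 p.2.1 p.2.2)
    (μ : Measure (ℝ × Z)) [IsFiniteMeasure μ] {f : ℝ × Q → ℝ} (hf : Measurable f) {C : ℝ}
    (hC : ∀ σ, |f σ| ≤ C) (σ : ℝ × Q) : Integrable (fun m => f (jumpStep ρ t σ m)) μ :=
  Integrable.of_bound (hf.comp (measurable_jumpStep_right hρ σ)).aestronglyMeasurable C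
    (ae_of_all _ fun _ => hC _)

lemma abs_jumpOp_le (μ : Measure (ℝ × Z)) [IsProbabilityMeasure μ] {f : ℝ × Q → ℝ} {C : ℝ}
    (hC : ∀ σ, |f σ| ≤ C) (σ : ℝ × Q) : |jumpOp ρ t μ f σ| ≤ C := by
  have h := norm_integral_le_of_norm_le_const (μ := μ) (f := fun m => f (jumpStep ρ t σ m))
    (ae_of_all _ fun _ => hC _)
  rwa [probReal_univ, mul_one] at h

lemma jumpOp_of_lt (μ : Measure (ℝ × Z)) [IsProbabilityMeasure μ] (f : ℝ × Q → ℝ) {σ : ℝ × Q}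
    (h : t < σ.1) : jumpOp ρ t μ f σ = f σ := by
  simp [jumpOp, jumpStep, not_le.2 h]

lemma measurable_iterate_jumpOp (hρ : Measurable fun p : Q × ℝ × Z => ρ p.1 p.2.1 p.2.2)
    (μ : Measure (ℝ × Z)) [SFinite μ] {f : ℝ × Q → ℝ} (hf : Measurable f) (n : ℕ) :
    Measurable ((jumpOp ρ t μ)^[n] f) := by
  induction n with
  | zero => exact hf
  | succ n ih => rw [Function.iterate_succ_apply']; exact measurable_jumpOp hρ μ ih

lemma abs_iterate_jumpOp_le (μ : Measure (ℝ × Z)) [IsProbabilityMeasure μ] {f : ℝ × Q → ℝ}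
    {C : ℝ} (hC : ∀ σ, |f σ| ≤ C) (n : ℕ) (σ : ℝ × Q) : |(jumpOp ρ t μ)^[n] f σ| ≤ C := by
  induction n generalizing σ with
  | zero => exact hC σ
  | succ n ih => rw [Function.iterate_succ_apply']; exact abs_jumpOp_le μ ih σ

lemma iterate_jumpOp_of_lt (μ : Measure (ℝ × Z)) [IsProbabilityMeasure μ] (f : ℝ × Q → ℝ)
    (n : ℕ) {σ : ℝ × Q} (h : t < σ.1) : (jumpOp ρ t μ)^[n] f σ = f σ := by
  induction n with
  | zero => rfl
  | succ n ih => rw [Function.iterate_succ_apply', jumpOp_of_lt μ _ h, ih]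

variable {θ : ℝ} {ν : Measure Z} [IsProbabilityMeasure ν]

lemma intervalIntegrable_integral_jump
    (hρ : Measurable fun p : Q × ℝ × Z => ρ p.1 p.2.1 p.2.2) {f : ℝ × Q → ℝ}
    (hf : Measurable f) {C : ℝ} (hC : ∀ σ, |f σ| ≤ C) (q : Q) (x y : ℝ) :
    IntervalIntegrable (fun r => ∫ z, f (r, ρ q r z) ∂ν) volume x y := by
  have hm : Measurable fun r => ∫ z, f (r, ρ q r z) ∂ν := by
    refine (StronglyMeasurable.integral_prod_right' (f := fun p : ℝ × Z => f (p.1, ρ q p.1 p.2))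
      (Measurable.stronglyMeasurable ?_)).measurable
    exact hf.comp (measurable_fst.prodMk
      (hρ.comp (measurable_const.prodMk (measurable_fst.prodMk measurable_snd))))
  refine (intervalIntegrable_const (c := C)).mono_fun hm.aestronglyMeasurable
    (ae_of_all _ fun r => ?_)
  have h := norm_integral_le_of_norm_le_const (μ := ν) (f := fun z => f (r, ρ q r z))
    (ae_of_all _ fun _ => hC _)
  simp only [probReal_univ, mul_one] at h
  exact h.trans (le_abs_self C)

/-- Conditioning on the first jump. If it falls after the horizon, the state is still q, and f is
required to be a constant c there. -/
lemma jumpOp_eq (hρ : Measurable fun p : Q × ℝ × Z => ρ p.1 p.2.1 p.2.2) (hθ : 0 < θ)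
    {f : ℝ × Q → ℝ} (hf : Measurable f) {C : ℝ} (hC : ∀ σ, |f σ| ≤ C) {s : ℝ} (hs : s ≤ t)
    (q : Q) (c : ℝ) (hc : ∀ r, t < r → f (r, q) = c) :
    jumpOp ρ t ((expMeasure θ).prod ν) f (s, q) =
      (∫ r in s..t, θ * Real.exp (-(θ * (r - s))) * ∫ z, f (r, ρ q r z) ∂ν) +
        Real.exp (-(θ * (t - s))) * c := by
  have := isProbabilityMeasure_expMeasure hθ
  rw [jumpOp, integral_prod _ (integrable_comp_jumpStep hρ _ hf hC _),
    ← integral_expMeasure_shift hθ hs _ _ (intervalIntegrable_integral_jump hρ hf hC q s t)]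
  refine integral_congr_ae (ae_of_all _ fun τ => ?_)
  by_cases h : s + τ ≤ t
  · simp [jumpStep, hs, h]
  · simp [jumpStep, hs, h, hc _ (not_le.1 h)]

/-- A function which dominates the indicator of the clock being before the horizon and which is
contracted by the transition operator. -/
noncomputable def clockWeight (Q : Type*) (t : ℝ) (σ : ℝ × Q) : ℝ :=
  if σ.1 ≤ t then Real.exp (t - σ.1) else 0

lemma measurable_clockWeight : Measurable (clockWeight Q t) :=
  Measurable.ite (measurableSet_le (by fun_prop) measurable_const) (by fun_prop) measurable_const

lemma clockWeight_nonneg (σ : ℝ × Q) : 0 ≤ clockWeight Q t σ := by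
  unfold clockWeight; split_ifs <;> positivity

lemma clockWeight_jumpStep_le (σ : ℝ × Q) (m : ℝ × Z) :
    clockWeight Q t (jumpStep ρ t σ m) ≤ clockWeight Q t σ * Real.exp (-m.1) := by
  by_cases h : σ.1 ≤ t
  · by_cases h' : σ.1 + m.1 ≤ t
    · simp only [clockWeight, jumpStep, h, h', if_true]
      rw [← Real.exp_add]
      exact le_of_eq (by congr 1; ring)
    · simp only [clockWeight, jumpStep, h, h', if_true, if_false]
      positivity
  · simp [clockWeight, jumpStep, h]

lemma integrable_exp_neg_expMeasure (hθ : 0 < θ) :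
    Integrable (fun τ => Real.exp (-τ)) (expMeasure θ) := by
  have := isProbabilityMeasure_expMeasure hθ
  -- A non-integrable function has Bochner integral 0, whereas the density formula, valid without
  -- integrability, gives θ/(θ+1) > 0.
  by_contra h
  have h1 := integral_expMeasure hθ (fun τ => Real.exp (-τ))
  rw [integral_undef h] at h1
  have h2 : ∀ τ : ℝ, θ * Real.exp (-(θ * τ)) * Real.exp (-τ) =
      θ * Real.exp (-(θ + 1) * τ) := by
    intro τ; rw [mul_assoc, ← Real.exp_add]; congr 2; ring
  simp_rw [h2] at h1
  rw [integral_const_mul, integral_exp_mul_Ioi (by linarith)] at h1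
  simp only [mul_zero, Real.exp_zero, neg_div_neg_eq] at h1
  have : 0 < θ * (1 / (θ + 1)) := by positivity
  linarith

lemma integral_exp_neg_expMeasure (hθ : 0 < θ) :
    ∫ τ, Real.exp (-τ) ∂(expMeasure θ) = θ / (θ + 1) := by
  rw [integral_expMeasure hθ]
  have h2 : ∀ τ : ℝ, θ * Real.exp (-(θ * τ)) * Real.exp (-τ) =
      θ * Real.exp (-(θ + 1) * τ) := by
    intro τ; rw [mul_assoc, ← Real.exp_add]; congr 2; ring
  simp_rw [h2]
  rw [integral_const_mul, integral_exp_mul_Ioi (by linarith)]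
  simp only [mul_zero, Real.exp_zero, neg_div_neg_eq]
  ring

lemma integrable_clockWeight_jumpStep
    (hρ : Measurable fun p : Q × ℝ × Z => ρ p.1 p.2.1 p.2.2) (hθ : 0 < θ) (σ : ℝ × Q) :
    Integrable (fun m => clockWeight Q t (jumpStep ρ t σ m)) ((expMeasure θ).prod ν) := by
  have := isProbabilityMeasure_expMeasure hθ
  refine (((integrable_exp_neg_expMeasure hθ).comp_fst ν).const_mul
    (clockWeight Q t σ)).mono' ?_ (ae_of_all _ fun m => ?_)
  · exact (measurable_clockWeight.comp (measurable_jumpStep_right hρ σ)).aestronglyMeasurable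
  · rw [Real.norm_of_nonneg (clockWeight_nonneg _)]
    exact clockWeight_jumpStep_le σ m

lemma jumpOp_clockWeight_le (hρ : Measurable fun p : Q × ℝ × Z => ρ p.1 p.2.1 p.2.2)
    (hθ : 0 < θ) (σ : ℝ × Q) :
    jumpOp ρ t ((expMeasure θ).prod ν) (clockWeight Q t) σ ≤
      θ / (θ + 1) * clockWeight Q t σ := by
  have := isProbabilityMeasure_expMeasure hθ
  calc jumpOp ρ t ((expMeasure θ).prod ν) (clockWeight Q t) σ
      ≤ ∫ m : ℝ × Z, clockWeight Q t σ * Real.exp (-m.1) ∂((expMeasure θ).prod ν) :=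
        integral_mono (integrable_clockWeight_jumpStep hρ hθ σ)
          (((integrable_exp_neg_expMeasure hθ).comp_fst ν).const_mul _)
          fun m => clockWeight_jumpStep_le σ m
    _ = θ / (θ + 1) * clockWeight Q t σ := by
        rw [integral_const_mul, integral_fun_fst (fun τ => Real.exp (-τ)),
          integral_exp_neg_expMeasure hθ]
        simp [mul_comm]

/-- The (n+1)-st step matters only if the clock has not passed the horizon after n steps. Each step
contracts `clockWeight` by the mean of e^{-τ}, which is θ/(θ+1), so the differences decay
geometrically and the iterates converge. -/
lemma abs_iterate_jumpOp_sub_le (hρ : Measurable fun p : Q × ℝ × Z => ρ p.1 p.2.1 p.2.2)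
    (hθ : 0 < θ) {F : Q → ℝ} (hF : Measurable F) {C : ℝ} (hC : ∀ q, |F q| ≤ C) (n : ℕ)
    (σ : ℝ × Q) :
    |(jumpOp ρ t ((expMeasure θ).prod ν))^[n + 1] (fun σ => F σ.2) σ -
      (jumpOp ρ t ((expMeasure θ).prod ν))^[n] (fun σ => F σ.2) σ| ≤
      2 * C * clockWeight Q t σ * (θ / (θ + 1)) ^ n := by
  have := isProbabilityMeasure_expMeasure hθ
  set μ := (expMeasure θ).prod ν
  set f : ℝ × Q → ℝ := fun σ => F σ.2
  have hf : Measurable f := hF.comp measurable_snd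
  have hfC : ∀ σ, |f σ| ≤ C := fun σ => hC _
  have hC0 : 0 ≤ C := (abs_nonneg _).trans (hC σ.2)
  induction n generalizing σ with
  | zero =>
    by_cases h : σ.1 ≤ t
    · have h1 : 1 ≤ clockWeight Q t σ := by
        simp only [clockWeight, h, if_true]
        exact Real.one_le_exp (by linarith)
      calc _ ≤ |(jumpOp ρ t μ)^[0 + 1] f σ| + |(jumpOp ρ t μ)^[0] f σ| := abs_sub _ _
        _ ≤ C + C := add_le_add (abs_iterate_jumpOp_le μ hfC _ σ) (abs_iterate_jumpOp_le μ hfC _ σ)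
        _ = 2 * C * 1 := by ring
        _ ≤ 2 * C * clockWeight Q t σ := by gcongr
        _ = _ := by simp
    · simp [jumpOp_of_lt μ f (not_le.1 h), clockWeight, h]
  | succ n ih =>
    rw [iterate_succ_jumpOp μ f (n + 1), iterate_succ_jumpOp μ f n]
    have hi : ∀ k, Integrable (fun m => (jumpOp ρ t μ)^[k] f (jumpStep ρ t σ m)) μ := fun k =>
      integrable_comp_jumpStep hρ μ (measurable_iterate_jumpOp hρ μ hf k)
        (abs_iterate_jumpOp_le μ hfC k) σ
    calc _ = |∫ m, ((jumpOp ρ t μ)^[n + 1] f (jumpStep ρ t σ m) -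
              (jumpOp ρ t μ)^[n] f (jumpStep ρ t σ m)) ∂μ| := by
          rw [integral_sub (hi (n + 1)) (hi n)]
      _ ≤ ∫ m, |(jumpOp ρ t μ)^[n + 1] f (jumpStep ρ t σ m) -
              (jumpOp ρ t μ)^[n] f (jumpStep ρ t σ m)| ∂μ := abs_integral_le_integral_abs
      _ ≤ ∫ m, 2 * C * clockWeight Q t (jumpStep ρ t σ m) * (θ / (θ + 1)) ^ n ∂μ :=
          integral_mono ((hi (n + 1)).sub (hi n)).abs
            (((integrable_clockWeight_jumpStep hρ hθ σ).const_mul _).mul_const _)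
            fun m => ih _
      _ = 2 * C * (θ / (θ + 1)) ^ n * jumpOp ρ t μ (clockWeight Q t) σ := by
          rw [integral_mul_const, integral_const_mul, jumpOp]; ring
      _ ≤ 2 * C * (θ / (θ + 1)) ^ n * (θ / (θ + 1) * clockWeight Q t σ) := by
          gcongr; exact jumpOp_clockWeight_le hρ hθ σ
      _ = _ := by ring

/-- The expected terminal value of the jump chain, as a function of the starting point. -/
theorem exists_jump_value (hρ : Measurable fun p : Q × ℝ × Z => ρ p.1 p.2.1 p.2.2)
    (hθ : 0 < θ) (t : ℝ) {F : Q → ℝ} (hF : Measurable F) {C : ℝ} (hC : ∀ q, |F q| ≤ C) :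
    ∃ V : ℝ × Q → ℝ, Measurable V ∧ (∀ σ, |V σ| ≤ C) ∧ (∀ r q, t < r → V (r, q) = F q) ∧
      (∀ σ, jumpOp ρ t ((expMeasure θ).prod ν) V σ = V σ) ∧
      ∀ σ, Tendsto (fun n => (jumpOp ρ t ((expMeasure θ).prod ν))^[n] (fun σ => F σ.2) σ)
        atTop (𝓝 (V σ)) := by
  have := isProbabilityMeasure_expMeasure hθ
  set μ := (expMeasure θ).prod ν with hμ
  set f : ℝ × Q → ℝ := fun σ => F σ.2
  have hf : Measurable f := hF.comp measurable_snd
  have hfC : ∀ σ, |f σ| ≤ C := fun σ => hC _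
  have hlim : ∀ σ, ∃ v, Tendsto (fun n => (jumpOp ρ t μ)^[n] f σ) atTop (𝓝 v) := by
    intro σ
    refine cauchySeq_tendsto_of_complete (cauchySeq_of_le_geometric (θ / (θ + 1))
      (2 * C * clockWeight Q t σ) ?_ fun n => ?_)
    · rw [div_lt_one (by linarith)]; linarith
    · rw [dist_comm, Real.dist_eq]
      exact abs_iterate_jumpOp_sub_le hρ hθ hF hC n σ
  choose V hV using hlim
  refine ⟨V, measurable_of_tendsto_metrizable (fun n => measurable_iterate_jumpOp hρ μ hf n)
    (tendsto_pi_nhds.2 hV), fun σ => ?_, fun r q hr => ?_, fun σ => ?_, hV⟩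
  · exact le_of_tendsto (hV σ).abs (Eventually.of_forall fun n => abs_iterate_jumpOp_le μ hfC n σ)
  · refine tendsto_nhds_unique (hV (r, q)) ?_
    simp_rw [iterate_jumpOp_of_lt μ f _ (show t < (r, q).1 from hr)]
    exact tendsto_const_nhds
  · refine tendsto_nhds_unique ?_ ((tendsto_add_atTop_iff_nat 1).2 (hV σ))
    simp_rw [Function.iterate_succ_apply']
    exact tendsto_integral_of_dominated_convergence (fun _ => C)
      (fun n => ((measurable_iterate_jumpOp hρ μ hf n).comp
        (measurable_jumpStep_right hρ σ)).aestronglyMeasurable) (integrable_const _)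
      (fun n => ae_of_all _ fun m => abs_iterate_jumpOp_le μ hfC n _)
      (ae_of_all _ fun m => hV _)

end JumpChain

/-! ### Sensitivity to the starting point, and accumulated variance. -/

section JumpChain

variable {Q Z : Type*} [MeasurableSpace Q] [MeasurableSpace Z] {ρ : Q → ℝ → Z → Q} {t : ℝ}
  {θ : ℝ} {ν : Measure Z} [IsProbabilityMeasure ν]

lemma integrable_comp_jump (hρ : Measurable fun p : Q × ℝ × Z => ρ p.1 p.2.1 p.2.2)
    {f : ℝ × Q → ℝ} (hf : Measurable f) {C : ℝ} (hC : ∀ σ, |f σ| ≤ C) (q : Q) (r : ℝ) :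
    Integrable (fun z => f (r, ρ q r z)) ν := by
  refine Integrable.of_bound (Measurable.aestronglyMeasurable ?_) C (ae_of_all _ fun _ => hC _)
  exact hf.comp (measurable_const.prodMk
    (hρ.comp (measurable_const.prodMk (measurable_const.prodMk measurable_id))))

/-- Comparison of the expected terminal values from two starting points, by a function `Φ` of the
pair of states and of the time to go which is a supersolution of the two-point equation. -/
theorem abs_iterate_jumpOp_sub_le_of_supersolution
    (hρ : Measurable fun p : Q × ℝ × Z => ρ p.1 p.2.1 p.2.2)
    (hθ : 0 < θ) {F : Q → ℝ} (hF : Measurable F) {C : ℝ} (hC : ∀ q, |F q| ≤ C)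
    {Φ Φ' : Q → Q → ℝ → ℝ} (hΦ : ∀ q q' τ, HasDerivAt (Φ q q') (Φ' q q' τ) τ)
    (hΦ' : ∀ q q', Continuous (Φ' q q')) (h0 : ∀ q q', |F q - F q'| ≤ Φ q q' 0)
    (hmono : ∀ q q' τ, 0 ≤ τ → Φ q q' 0 ≤ Φ q q' τ)
    (hstep : ∀ q q' r, r ≤ t → ∃ β : Z → ℝ, Integrable β ν ∧
      (∀ z, Φ (ρ q r z) (ρ q' r z) (t - r) ≤ β z) ∧
      ∫ z, β z ∂ν ≤ Φ q q' (t - r) + Φ' q q' (t - r) / θ)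
    (n : ℕ) {s : ℝ} (hs : s ≤ t) (q q' : Q) :
    |(jumpOp ρ t ((expMeasure θ).prod ν))^[n] (fun σ => F σ.2) (s, q) -
      (jumpOp ρ t ((expMeasure θ).prod ν))^[n] (fun σ => F σ.2) (s, q')| ≤ Φ q q' (t - s) := by
  have := isProbabilityMeasure_expMeasure hθ
  set μ := (expMeasure θ).prod ν
  set f : ℝ × Q → ℝ := fun σ => F σ.2 with hfdef
  have hf : Measurable f := hF.comp measurable_snd
  have hfC : ∀ σ, |f σ| ≤ C := fun σ => hC _
  induction n generalizing s q q' with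
  | zero => exact (h0 q q').trans (hmono q q' _ (by linarith))
  | succ n ih =>
    set g := (jumpOp ρ t μ)^[n] f with hg
    have hgm : Measurable g := measurable_iterate_jumpOp hρ μ hf n
    have hgC : ∀ σ, |g σ| ≤ C := abs_iterate_jumpOp_le μ hfC n
    have hgt : ∀ q r, t < r → g (r, q) = F q := fun q r hr =>
      iterate_jumpOp_of_lt μ f n (σ := (r, q)) hr
    have hii : ∀ q, IntervalIntegrable
        (fun r => θ * Real.exp (-(θ * (r - s))) * ∫ z, g (r, ρ q r z) ∂ν) volume s t := fun q =>
      (intervalIntegrable_integral_jump hρ hgm hgC q s t).continuousOn_mul (by fun_prop)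
    have hΦc : Continuous (Φ q q') :=
      continuous_iff_continuousAt.2 fun τ => (hΦ q q' τ).continuousAt
    have hc := hΦ' q q'
    -- The two values and Φ are all expanded at the first jump. Both copies use the same jump time r
    -- and the same mark z, which is the coupling.
    rw [Function.iterate_succ_apply', jumpOp_eq hρ hθ hgm hgC hs q _ (hgt q),
      jumpOp_eq hρ hθ hgm hgC hs q' _ (hgt q'), ← renewal_integral hθ s t (hΦ q q') (hΦ' q q'),
      add_sub_add_comm, ← intervalIntegral.integral_sub (hii q) (hii q'), ← mul_sub]
    refine (abs_add_le _ _).trans (add_le_add ?_ ?_)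
    · refine (intervalIntegral.abs_integral_le_integral_abs hs).trans
        (intervalIntegral.integral_mono_on hs ((hii q).sub (hii q')).abs
          (Continuous.intervalIntegrable (by fun_prop) _ _) fun r hr => ?_)
      rw [← mul_sub, abs_mul, abs_of_nonneg (a := θ * _) (by positivity)]
      refine mul_le_mul_of_nonneg_left ?_ (by positivity)
      obtain ⟨β, hβ, hle, hint⟩ := hstep q q' r hr.2
      have hi := fun q => integrable_comp_jump (ν := ν) hρ hgm hgC q r
      rw [← integral_sub (hi q) (hi q')]
      refine abs_integral_le_integral_abs.trans (le_trans ?_ hint)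
      exact integral_mono ((hi q).sub (hi q')).abs hβ fun z => (ih hr.2 _ _).trans (hle z)
    · rw [abs_mul, abs_of_nonneg (Real.exp_nonneg _)]
      exact mul_le_mul_of_nonneg_left (h0 q q') (Real.exp_nonneg _)

/-- The variance created by the first jump. -/
lemma jumpOp_sq_eq (hρ : Measurable fun p : Q × ℝ × Z => ρ p.1 p.2.1 p.2.2) (hθ : 0 < θ)
    {F : Q → ℝ} {V : ℝ × Q → ℝ} (hV : Measurable V) {C : ℝ} (hC : ∀ σ, |V σ| ≤ C)
    (hVt : ∀ r q, t < r → V (r, q) = F q)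
    (hfix : ∀ σ, jumpOp ρ t ((expMeasure θ).prod ν) V σ = V σ) {s : ℝ} (hs : s ≤ t) (q : Q) :
    IntervalIntegrable (fun r => θ * Real.exp (-(θ * (r - s))) *
        ∫ z, (V (r, ρ q r z) - V (r, q)) ^ 2 ∂ν) volume s t ∧
    (∫ r in s..t, θ * Real.exp (-(θ * (r - s))) * ∫ z, V (r, ρ q r z) ^ 2 ∂ν) +
        Real.exp (-(θ * (t - s))) * F q ^ 2 =
      V (s, q) ^ 2 + ∫ r in s..t, θ * Real.exp (-(θ * (r - s))) *
        ∫ z, (V (r, ρ q r z) - V (r, q)) ^ 2 ∂ν := by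
  have hV2 : Measurable fun σ => V σ ^ 2 := hV.pow_const 2
  have hC2 : ∀ σ, |V σ ^ 2| ≤ C ^ 2 := fun σ => by
    rw [abs_pow]; exact pow_le_pow_left₀ (abs_nonneg _) (hC σ) 2
  -- As V is a fixed point, the first-jump equation with the same q holds from every r in [s, t],
  -- which makes `jump_variance_identity` applicable.
  have hv : ∀ r ∈ Set.Icc s t, V (r, q) =
      (∫ x in r..t, θ * Real.exp (-(θ * (x - r))) * ∫ z, V (x, ρ q x z) ∂ν) +
        Real.exp (-(θ * (t - r))) * F q := fun r hr => by
    rw [← hfix, jumpOp_eq hρ hθ hV hC hr.2 q _ fun r hr => hVt r q hr]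
  have hid := jump_variance_identity (θ := θ) hs (F q) (fun r => ∫ z, V (r, ρ q r z) ∂ν)
    (fun r => V (r, q)) (intervalIntegrable_integral_jump hρ hV hC q) hv
  have hvi : IntervalIntegrable (fun r => V (r, q)) volume s t :=
    (intervalIntegrable_const (c := C)).mono_fun
      (hV.comp (measurable_id.prodMk measurable_const)).aestronglyMeasurable
      (ae_of_all _ fun r => (hC _).trans (le_abs_self C))
  have hv2i : IntervalIntegrable (fun r => V (r, q) ^ 2) volume s t :=
    (intervalIntegrable_const (c := C ^ 2)).mono_fun
      (hV2.comp (measurable_id.prodMk measurable_const)).aestronglyMeasurable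
      (ae_of_all _ fun r => (hC2 _).trans (le_abs_self _))
  have hai := intervalIntegrable_integral_jump (ν := ν) hρ hV hC q s t
  have ha2i := intervalIntegrable_integral_jump (ν := ν) hρ hV2 hC2 q s t
  have havi : IntervalIntegrable (fun r => 2 * (∫ z, V (r, ρ q r z) ∂ν) * V (r, q)) volume s t := by
    refine (intervalIntegrable_const (c := 2 * C * C)).mono_fun
      (by rw [Set.uIoc_of_le hs]
          exact (hai.aestronglyMeasurable.const_mul 2).mul hvi.aestronglyMeasurable)
      (ae_of_all _ fun r => ?_)
    have h := norm_integral_le_of_norm_le_const (μ := ν) (f := fun z => V (r, ρ q r z))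
      (ae_of_all _ fun _ => hC _)
    rw [probReal_univ, mul_one] at h
    refine le_trans ?_ (le_abs_self _)
    change ‖2 * (∫ z, V (r, ρ q r z) ∂ν) * V (r, q)‖ ≤ 2 * C * C
    rw [norm_mul, norm_mul]
    have hC0 : 0 ≤ C := (abs_nonneg _).trans (hC (r, q))
    have := hC (r, q)
    rw [← Real.norm_eq_abs] at this
    rw [Real.norm_ofNat]
    gcongr
  have hpt : ∀ r, ∫ z, (V (r, ρ q r z) - V (r, q)) ^ 2 ∂ν =
      (∫ z, V (r, ρ q r z) ^ 2 ∂ν) +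
        (V (r, q) ^ 2 - 2 * (∫ z, V (r, ρ q r z) ∂ν) * V (r, q)) := by
    intro r
    have h1 := integrable_comp_jump (ν := ν) hρ hV hC q r
    have h2 := integrable_comp_jump (ν := ν) hρ hV2 hC2 q r
    have : ∀ z, (V (r, ρ q r z) - V (r, q)) ^ 2 =
        V (r, ρ q r z) ^ 2 + (V (r, q) ^ 2 - 2 * V (r, q) * V (r, ρ q r z)) := fun z => by ring
    simp_rw [this]
    have h3 : Integrable (fun z => V (r, q) ^ 2 - 2 * V (r, q) * V (r, ρ q r z)) ν :=
      (integrable_const _).sub (h1.const_mul _)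
    rw [integral_add h2 h3,
      integral_sub (integrable_const _) (h1.const_mul _), integral_const_mul]
    simp only [integral_const, probReal_univ, one_smul]
    ring
  have hk : ContinuousOn (fun r => θ * Real.exp (-(θ * (r - s)))) (Set.uIcc s t) := by fun_prop
  simp_rw [hpt, mul_add]
  refine ⟨(ha2i.continuousOn_mul hk).add ((hv2i.sub havi).continuousOn_mul hk), ?_⟩
  rw [intervalIntegral.integral_add (ha2i.continuousOn_mul hk)
    ((hv2i.sub havi).continuousOn_mul hk), ← hid]
  ring

/-- ψ' is the jump rate θ times a bound on the squared jump of V. Inductively, the first jump adds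
its own variance and the later ones at most ψ(t-r); `renewal_integral` sums these to ψ(t-s). -/
theorem iterate_jumpOp_sq_le (hρ : Measurable fun p : Q × ℝ × Z => ρ p.1 p.2.1 p.2.2)
    (hθ : 0 < θ) {F : Q → ℝ} {V : ℝ × Q → ℝ} (hV : Measurable V) {C : ℝ} (hC : ∀ σ, |V σ| ≤ C)
    (hVt : ∀ r q, t < r → V (r, q) = F q)
    (hfix : ∀ σ, jumpOp ρ t ((expMeasure θ).prod ν) V σ = V σ)
    {ψ ψ' : ℝ → ℝ} (hψ : ∀ τ, HasDerivAt ψ (ψ' τ) τ) (hψ' : Continuous ψ') (hψ0 : ψ 0 = 0)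
    (hψnn : ∀ τ, 0 ≤ τ → 0 ≤ ψ τ)
    (hjump : ∀ q r z, r ≤ t → (V (r, ρ q r z) - V (r, q)) ^ 2 ≤ ψ' (t - r) / θ)
    (n : ℕ) {s : ℝ} (hs : s ≤ t) (q : Q) :
    (jumpOp ρ t ((expMeasure θ).prod ν))^[n] (fun σ => V σ ^ 2) (s, q) ≤
      V (s, q) ^ 2 + ψ (t - s) := by
  have := isProbabilityMeasure_expMeasure hθ
  have hV2 : Measurable fun σ => V σ ^ 2 := hV.pow_const 2
  have hC2 : ∀ σ, |V σ ^ 2| ≤ C ^ 2 := fun σ => by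
    rw [abs_pow]; exact pow_le_pow_left₀ (abs_nonneg _) (hC σ) 2
  have hψc : Continuous ψ := continuous_iff_continuousAt.2 fun τ => (hψ τ).continuousAt
  induction n generalizing s q with
  | zero => simpa using hψnn (t - s) (by linarith)
  | succ n ih =>
    set μ := (expMeasure θ).prod ν
    set g := (jumpOp ρ t μ)^[n] (fun σ => V σ ^ 2) with hg
    have hgm : Measurable g := measurable_iterate_jumpOp hρ μ hV2 n
    have hgC : ∀ σ, |g σ| ≤ C ^ 2 := abs_iterate_jumpOp_le μ hC2 n
    have hgt : ∀ r, t < r → g (r, q) = F q ^ 2 := fun r hr => by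
      rw [hg, iterate_jumpOp_of_lt μ _ n (σ := (r, q)) hr, hVt r q hr]
    have hk : ContinuousOn (fun r => θ * Real.exp (-(θ * (r - s)))) (Set.uIcc s t) := by fun_prop
    have hgi := (intervalIntegrable_integral_jump (ν := ν) hρ hgm hgC q s t).continuousOn_mul hk
    have ha2i := (intervalIntegrable_integral_jump (ν := ν) hρ hV2 hC2 q s t).continuousOn_mul hk
    have hψi : IntervalIntegrable (fun r => θ * Real.exp (-(θ * (r - s))) * ψ (t - r))
      volume s t := Continuous.intervalIntegrable (by fun_prop) _ _
    have hψi' : IntervalIntegrable (fun r => θ * Real.exp (-(θ * (r - s))) * (ψ' (t - r) / θ))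
      volume s t := Continuous.intervalIntegrable (by fun_prop) _ _
    have hren := renewal_integral hθ s t hψ hψ'
    simp_rw [mul_add] at hren
    rw [hψ0, mul_zero, add_zero, intervalIntegral.integral_add hψi hψi'] at hren
    obtain ⟨hsqi, hsq⟩ := jumpOp_sq_eq hρ hθ hV hC hVt hfix hs q
    have h1 : ∫ r in s..t, θ * Real.exp (-(θ * (r - s))) * ∫ z, g (r, ρ q r z) ∂ν ≤
        ∫ r in s..t, (θ * Real.exp (-(θ * (r - s))) * (∫ z, V (r, ρ q r z) ^ 2 ∂ν) +
          θ * Real.exp (-(θ * (r - s))) * ψ (t - r)) := by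
      refine intervalIntegral.integral_mono_on hs hgi (ha2i.add hψi) fun r hr => ?_
      rw [← mul_add]
      refine mul_le_mul_of_nonneg_left ?_ (by positivity)
      have hi2 := integrable_comp_jump (ν := ν) hρ hV2 hC2 q r
      calc ∫ z, g (r, ρ q r z) ∂ν ≤ ∫ z, (V (r, ρ q r z) ^ 2 + ψ (t - r)) ∂ν :=
            integral_mono (integrable_comp_jump hρ hgm hgC q r) (hi2.add (integrable_const _))
              fun z => ih hr.2 _
        _ = _ := by rw [integral_add hi2 (integrable_const _)]; simp
    rw [intervalIntegral.integral_add ha2i hψi] at h1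
    have h2 : ∫ r in s..t, θ * Real.exp (-(θ * (r - s))) *
        ∫ z, (V (r, ρ q r z) - V (r, q)) ^ 2 ∂ν ≤
        ∫ r in s..t, θ * Real.exp (-(θ * (r - s))) * (ψ' (t - r) / θ) := by
      refine intervalIntegral.integral_mono_on hs hsqi hψi' fun r hr => ?_
      refine mul_le_mul_of_nonneg_left ?_ (by positivity)
      calc ∫ z, (V (r, ρ q r z) - V (r, q)) ^ 2 ∂ν ≤ ∫ z, ψ' (t - r) / θ ∂ν :=
            integral_mono_of_nonneg (ae_of_all _ fun z => sq_nonneg _)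
              (integrable_const _) (ae_of_all _ fun z => hjump q r z hr.2)
        _ = ψ' (t - r) / θ := by simp
    rw [Function.iterate_succ_apply', jumpOp_eq hρ hθ hgm hgC hs q _ hgt]
    linarith

end JumpChain

/-! ### Random realizations of the jump chain. -/

section ChainRealization

variable {Q Z Ω : Type*} [MeasurableSpace Q] [MeasurableSpace Z] [MeasurableSpace Ω]
  {ρ : Q → ℝ → Z → Q} {t : ℝ} {θ : ℝ} {ν : Measure Z} [IsProbabilityMeasure ν]
  {P : Measure Ω} [IsProbabilityMeasure P] {σ : ℕ → Ω → ℝ × Q} {M : ℕ → Ω → ℝ × Z}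

lemma integral_chain_succ {μ : Measure (ℝ × Z)} [IsProbabilityMeasure μ]
    (hρ : Measurable fun p : Q × ℝ × Z => ρ p.1 p.2.1 p.2.2)
    (hσ : ∀ n, Measurable (σ n)) (hM : ∀ n, Measurable (M n))
    (hstep : ∀ n ω, σ (n + 1) ω = jumpStep ρ t (σ n ω) (M n ω))
    (hind : ∀ n, IndepFun (σ n) (M n) P) (hlaw : ∀ n, P.map (M n) = μ)
    {f : ℝ × Q → ℝ} (hf : Measurable f) {C : ℝ} (hC : ∀ σ, |f σ| ≤ C) (n : ℕ) :
    ∫ ω, f (σ (n + 1) ω) ∂P = ∫ ω, jumpOp ρ t μ f (σ n ω) ∂P := by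
  have := Measure.isProbabilityMeasure_map (μ := P) (hσ n).aemeasurable
  have hprod := (indepFun_iff_map_prod_eq_prod_map_map (hσ n).aemeasurable
    (hM n).aemeasurable).1 (hind n)
  have hfm : Measurable fun p : (ℝ × Q) × (ℝ × Z) => f (jumpStep ρ t p.1 p.2) :=
    hf.comp (measurable_jumpStep hρ)
  simp_rw [hstep]
  have h1 : ∫ ω, f (jumpStep ρ t (σ n ω) (M n ω)) ∂P =
      ∫ p, f (jumpStep ρ t p.1 p.2) ∂(P.map fun ω => (σ n ω, M n ω)) :=
    (integral_map ((hσ n).prodMk (hM n)).aemeasurable hfm.aestronglyMeasurable).symm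
  rw [h1, hprod, hlaw, integral_prod _ (Integrable.of_bound hfm.aestronglyMeasurable C
    (ae_of_all _ fun _ => hC _))]
  exact integral_map (hσ n).aemeasurable (measurable_jumpOp hρ μ hf).aestronglyMeasurable

lemma integral_chain {μ : Measure (ℝ × Z)} [IsProbabilityMeasure μ]
    (hρ : Measurable fun p : Q × ℝ × Z => ρ p.1 p.2.1 p.2.2)
    (hσ : ∀ n, Measurable (σ n)) (hM : ∀ n, Measurable (M n))
    (hstep : ∀ n ω, σ (n + 1) ω = jumpStep ρ t (σ n ω) (M n ω))
    (hind : ∀ n, IndepFun (σ n) (M n) P) (hlaw : ∀ n, P.map (M n) = μ)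
    {f : ℝ × Q → ℝ} (hf : Measurable f) {C : ℝ} (hC : ∀ σ, |f σ| ≤ C) (n : ℕ) :
    ∫ ω, f (σ n ω) ∂P = ∫ ω, (jumpOp ρ t μ)^[n] f (σ 0 ω) ∂P := by
  induction n generalizing f with
  | zero => rfl
  | succ n ih =>
    rw [integral_chain_succ hρ hσ hM hstep hind hlaw hf hC,
      ih (measurable_jumpOp hρ μ hf) (abs_jumpOp_le μ hC)]
    rfl

lemma chain_frozen (hstep : ∀ n ω, σ (n + 1) ω = jumpStep ρ t (σ n ω) (M n ω)) {ω : Ω} {n : ℕ}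
    (h : t < (σ n ω).1) {m : ℕ} (hm : n ≤ m) : σ m ω = σ n ω := by
  induction m, hm using Nat.le_induction with
  | base => rfl
  | succ m _ ih => rw [hstep, ih, jumpStep, if_neg (not_le.2 h)]

lemma iterate_jumpOp_indicator_le (hρ : Measurable fun p : Q × ℝ × Z => ρ p.1 p.2.1 p.2.2)
    (hθ : 0 < θ) (n : ℕ) (p : ℝ × Q) :
    (jumpOp ρ t ((expMeasure θ).prod ν))^[n] (fun p => if p.1 ≤ t then 1 else 0) p ≤
      (θ / (θ + 1)) ^ n * clockWeight Q t p := by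
  have := isProbabilityMeasure_expMeasure hθ
  set μ := (expMeasure θ).prod ν
  set f : ℝ × Q → ℝ := fun p => if p.1 ≤ t then 1 else 0
  have hf : Measurable f := Measurable.ite (measurableSet_le (by fun_prop) measurable_const)
    measurable_const measurable_const
  have hfC : ∀ p, |f p| ≤ 1 := fun p => by simp only [f]; split_ifs <;> simp
  induction n generalizing p with
  | zero =>
    simp only [f, Function.iterate_zero, id, pow_zero, one_mul, clockWeight]
    split_ifs with h
    · exact Real.one_le_exp (by linarith)
    · exact le_rfl
  | succ n ih =>
    rw [iterate_succ_jumpOp]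
    calc _ ≤ ∫ m, (θ / (θ + 1)) ^ n * clockWeight Q t (jumpStep ρ t p m) ∂μ :=
          integral_mono (integrable_comp_jumpStep hρ μ (measurable_iterate_jumpOp hρ μ hf n)
            (abs_iterate_jumpOp_le μ hfC n) p)
            ((integrable_clockWeight_jumpStep hρ hθ p).const_mul _) fun m => ih _
      _ = (θ / (θ + 1)) ^ n * jumpOp ρ t μ (clockWeight Q t) p := by
          rw [integral_const_mul, jumpOp]
      _ ≤ (θ / (θ + 1)) ^ n * (θ / (θ + 1) * clockWeight Q t p) := by
          gcongr; exact jumpOp_clockWeight_le hρ hθ p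
      _ = _ := by ring

/-- Non-explosion: after n steps the clock is still before t with probability at most (θ/(θ+1))^n
e^t. -/
lemma ae_exists_chain_gt (hρ : Measurable fun p : Q × ℝ × Z => ρ p.1 p.2.1 p.2.2) (hθ : 0 < θ)
    (hσ : ∀ n, Measurable (σ n)) (hM : ∀ n, Measurable (M n))
    (hstep : ∀ n ω, σ (n + 1) ω = jumpStep ρ t (σ n ω) (M n ω))
    (hind : ∀ n, IndepFun (σ n) (M n) P) (hlaw : ∀ n, P.map (M n) = (expMeasure θ).prod ν)
    (h0 : ∀ ω, (σ 0 ω).1 = 0) : ∀ᵐ ω ∂P, ∃ n, t < (σ n ω).1 := by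
  have := isProbabilityMeasure_expMeasure hθ
  set f : ℝ × Q → ℝ := fun p => if p.1 ≤ t then 1 else 0
  have hf : Measurable f := Measurable.ite (measurableSet_le (by fun_prop) measurable_const)
    measurable_const measurable_const
  have hfC : ∀ p, |f p| ≤ 1 := fun p => by simp only [f]; split_ifs <;> simp
  have hms : ∀ n, MeasurableSet {ω | (σ n ω).1 ≤ t} := fun n =>
    measurableSet_le (hσ n).fst measurable_const
  have hle : ∀ n, P.real {ω | (σ n ω).1 ≤ t} ≤ (θ / (θ + 1)) ^ n * Real.exp t := by
    intro n
    have h1 : P.real {ω | (σ n ω).1 ≤ t} = ∫ ω, f (σ n ω) ∂P := by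
      rw [← integral_indicator_one (hms n)]
      rfl
    rw [h1, integral_chain hρ hσ hM hstep hind hlaw hf hfC n]
    calc _ ≤ ∫ ω, (θ / (θ + 1)) ^ n * Real.exp t ∂P := by
          refine integral_mono (Integrable.of_bound ((measurable_iterate_jumpOp hρ _ hf n).comp
            (hσ 0)).aestronglyMeasurable 1 (ae_of_all _ fun ω => abs_iterate_jumpOp_le _ hfC n _))
            (integrable_const _) fun ω => ?_
          refine (iterate_jumpOp_indicator_le hρ hθ n _).trans ?_
          refine mul_le_mul_of_nonneg_left ?_ (by positivity)
          rw [clockWeight, h0]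
          split_ifs
          · simp
          · positivity
      _ = _ := by simp
  have hzero : P.real {ω | ∀ n, (σ n ω).1 ≤ t} = 0 := by
    have hlim : Tendsto (fun n => (θ / (θ + 1)) ^ n * Real.exp t) atTop (𝓝 (0 * Real.exp t)) :=
      (tendsto_pow_atTop_nhds_zero_of_lt_one (by positivity)
        (by rw [div_lt_one (by linarith)]; linarith)).mul_const _
    rw [zero_mul] at hlim
    exact le_antisymm (ge_of_tendsto' hlim fun n =>
      (measureReal_mono fun ω (hω : ∀ n, (σ n ω).1 ≤ t) => hω n).trans (hle n)) measureReal_nonneg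
  rw [measureReal_eq_zero_iff] at hzero
  rw [ae_iff]
  convert hzero using 2
  ext ω
  simp

/-- Mean and second moment of the terminal value of a realization of the jump chain. -/
theorem chain_terminal_moments (hρ : Measurable fun p : Q × ℝ × Z => ρ p.1 p.2.1 p.2.2)
    (hθ : 0 < θ) (ht : 0 ≤ t) {F : Q → ℝ} {V : ℝ × Q → ℝ} (hV : Measurable V) {C : ℝ}
    (hC : ∀ σ, |V σ| ≤ C) (hVt : ∀ r q, t < r → V (r, q) = F q)
    (hfix : ∀ σ, jumpOp ρ t ((expMeasure θ).prod ν) V σ = V σ)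
    {ψ ψ' : ℝ → ℝ} (hψ : ∀ τ, HasDerivAt ψ (ψ' τ) τ) (hψ' : Continuous ψ') (hψ0 : ψ 0 = 0)
    (hψnn : ∀ τ, 0 ≤ τ → 0 ≤ ψ τ)
    (hjump : ∀ q r z, r ≤ t → (V (r, ρ q r z) - V (r, q)) ^ 2 ≤ ψ' (t - r) / θ)
    (hσ : ∀ n, Measurable (σ n)) (hM : ∀ n, Measurable (M n))
    (hstep : ∀ n ω, σ (n + 1) ω = jumpStep ρ t (σ n ω) (M n ω))
    (hind : ∀ n, IndepFun (σ n) (M n) P) (hlaw : ∀ n, P.map (M n) = (expMeasure θ).prod ν)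
    (h0 : ∀ ω, (σ 0 ω).1 = 0) {X : Ω → ℝ}
    (hX : ∀ᵐ ω ∂P, ∀ n, t < (σ n ω).1 → F (σ n ω).2 = X ω) :
    ∫ ω, X ω ∂P = ∫ ω, V (σ 0 ω) ∂P ∧
      ∫ ω, X ω ^ 2 ∂P ≤ (∫ ω, V (σ 0 ω) ^ 2 ∂P) + ψ t := by
  have := isProbabilityMeasure_expMeasure hθ
  set μ := (expMeasure θ).prod ν
  have hV2 : Measurable fun σ => V σ ^ 2 := hV.pow_const 2
  have hC2 : ∀ σ, |V σ ^ 2| ≤ C ^ 2 := fun σ => by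
    rw [abs_pow]; exact pow_le_pow_left₀ (abs_nonneg _) (hC σ) 2
  -- Once the clock passes t the chain is frozen and V equals F, so the sequence is eventually
  -- constant.
  have hlim : ∀ᵐ ω ∂P, Tendsto (fun n => V (σ n ω)) atTop (𝓝 (X ω)) := by
    filter_upwards [hX, ae_exists_chain_gt hρ hθ hσ hM hstep hind hlaw h0] with ω hω ⟨n, hn⟩
    refine tendsto_const_nhds.congr' ?_
    filter_upwards [eventually_ge_atTop n] with m hm
    rw [chain_frozen hstep hn hm, ← hω n hn]
    exact (hVt _ _ hn).symm
  have hlim1 : Tendsto (fun n => ∫ ω, V (σ n ω) ∂P) atTop (𝓝 (∫ ω, X ω ∂P)) :=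
    tendsto_integral_of_dominated_convergence (fun _ => C)
      (fun n => (hV.comp (hσ n)).aestronglyMeasurable) (integrable_const _)
      (fun n => ae_of_all _ fun ω => hC _) hlim
  have hlim2 : Tendsto (fun n => ∫ ω, V (σ n ω) ^ 2 ∂P) atTop (𝓝 (∫ ω, X ω ^ 2 ∂P)) :=
    tendsto_integral_of_dominated_convergence (fun _ => C ^ 2)
      (fun n => (hV2.comp (hσ n)).aestronglyMeasurable) (integrable_const _)
      (fun n => ae_of_all _ fun ω => hC2 _) (hlim.mono fun ω hω => hω.pow 2)
  -- This invariance makes the mean of V along the chain constant.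
  have hVi : ∀ n, (jumpOp ρ t μ)^[n] V = V := fun n =>
    Function.iterate_fixed (funext hfix) n
  constructor
  · refine tendsto_nhds_unique hlim1 (tendsto_const_nhds.congr fun n => ?_)
    rw [integral_chain hρ hσ hM hstep hind hlaw hV hC n, hVi]
  · refine le_of_tendsto' hlim2 fun n => ?_
    rw [integral_chain hρ hσ hM hstep hind hlaw hV2 hC2 n]
    have hi : Integrable (fun ω => V (σ 0 ω) ^ 2) P :=
      Integrable.of_bound (hV2.comp (hσ 0)).aestronglyMeasurable _ (ae_of_all _ fun ω => hC2 _)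
    calc _ ≤ ∫ ω, (V (σ 0 ω) ^ 2 + ψ t) ∂P := by
          refine integral_mono (Integrable.of_bound ((measurable_iterate_jumpOp hρ _ hV2 n).comp
            (hσ 0)).aestronglyMeasurable (C ^ 2)
            (ae_of_all _ fun ω => abs_iterate_jumpOp_le _ hC2 n _))
            (hi.add (integrable_const _)) fun ω => ?_
          have h := iterate_jumpOp_sq_le hρ hθ hV hC hVt hfix hψ hψ' hψ0 hψnn hjump n
            (s := (σ 0 ω).1) (by rw [h0]; exact ht) (σ 0 ω).2
          rwa [Prod.mk.eta, h0, sub_zero] at h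
      _ = _ := by rw [integral_add hi (integrable_const _)]; simp

end ChainRealization

/-! ### Variance of functions of independent variables. -/

/-- Averaging the oscillation bound over y shows that every value of h is within b of its mean. -/
lemma integral_sq_le_of_abs_sub_le {E : Type*} [MeasurableSpace E] (μ : Measure E)
    [IsProbabilityMeasure μ] {h : E → ℝ} (hm : Measurable h) {C : ℝ} (hC : ∀ x, |h x| ≤ C) {b : ℝ}
    (hb : ∀ x y, |h x - h y| ≤ b) : ∫ x, h x ^ 2 ∂μ ≤ (∫ x, h x ∂μ) ^ 2 + b ^ 2 := by
  have hi : Integrable h μ := Integrable.of_bound hm.aestronglyMeasurable C (ae_of_all _ hC)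
  have hi2 : Integrable (fun x => h x ^ 2) μ :=
    Integrable.of_bound (hm.pow_const 2).aestronglyMeasurable (C ^ 2) (ae_of_all _ fun x => by
      rw [Real.norm_eq_abs, abs_pow]; exact pow_le_pow_left₀ (abs_nonneg _) (hC x) 2)
  set c := ∫ x, h x ∂μ
  have h1 : ∀ x, (h x - c) ^ 2 ≤ b ^ 2 := by
    intro x
    have : h x - c = ∫ y, (h x - h y) ∂μ := by
      rw [integral_sub (integrable_const _) hi]; simp [c]
    have h2 := norm_integral_le_of_norm_le_const (μ := μ) (f := fun y => h x - h y)
      (ae_of_all _ fun y => hb x y)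
    rw [← this, probReal_univ, mul_one, Real.norm_eq_abs] at h2
    rw [← sq_abs]
    exact pow_le_pow_left₀ (abs_nonneg _) h2 2
  have h3 : ∫ x, (h x - c) ^ 2 ∂μ = ∫ x, h x ^ 2 ∂μ - c ^ 2 := by
    have : ∀ x, (h x - c) ^ 2 = h x ^ 2 - (2 * c * h x - c ^ 2) := fun x => by ring
    simp_rw [this]
    have h4 : Integrable (fun x => 2 * c * h x - c ^ 2) μ :=
      (hi.const_mul _).sub (integrable_const _)
    rw [integral_sub hi2 h4, integral_sub (hi.const_mul _) (integrable_const _),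
      integral_const_mul]
    simp only [integral_const, probReal_univ, one_smul]
    change _ - (2 * c * c - _) = _
    ring
  have h5 : ∫ x, (h x - c) ^ 2 ∂μ ≤ ∫ _, b ^ 2 ∂μ :=
    integral_mono_of_nonneg (ae_of_all _ fun x => sq_nonneg _) (integrable_const _)
      (ae_of_all _ h1)
  simp only [integral_const, probReal_univ, one_smul] at h5
  linarith

/-- The variance of a function of independent variables with bounded differences. -/
theorem integral_pi_sq_le_of_bounded_differences {E : Type*} [MeasurableSpace E] {n : ℕ}
    (μ : Fin n → Measure E) [∀ i, IsProbabilityMeasure (μ i)] {g : (Fin n → E) → ℝ}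
    (hg : Measurable g) {C : ℝ} (hC : ∀ x, |g x| ≤ C) {b : ℝ}
    (hb : ∀ x i e, |g (Function.update x i e) - g x| ≤ b) :
    ∫ x, g x ^ 2 ∂(Measure.pi μ) ≤ (∫ x, g x ∂(Measure.pi μ)) ^ 2 + n * b ^ 2 := by
  induction n with
  | zero =>
    have : ∀ x, g x = g default := fun x => congrArg g (Subsingleton.elim _ _)
    simp_rw [this]
    simp
  | succ n ih =>
    have hmp := (measurePreserving_piFinSuccAbove μ 0).symm
    set e := (MeasurableEquiv.piFinSuccAbove (fun _ : Fin (n + 1) => E) 0).symm with he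
    set π := Measure.pi fun j : Fin n => μ (Fin.succAbove 0 j) with hπ
    have hcons : ∀ x y, e (x, y) = (Fin.cons x y : Fin (n + 1) → E) := fun x y => by
      simp [he, MeasurableEquiv.piFinSuccAbove, Fin.consEquiv]
    have hgm : Measurable fun p : E × (Fin n → E) => g (e p) := hg.comp e.measurable
    have hgi : Integrable (fun p : E × (Fin n → E) => g (e p)) ((μ 0).prod π) :=
      Integrable.of_bound hgm.aestronglyMeasurable C (ae_of_all _ fun _ => hC _)
    have hg2i : Integrable (fun p : E × (Fin n → E) => g (e p) ^ 2) ((μ 0).prod π) :=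
      Integrable.of_bound (hgm.pow_const 2).aestronglyMeasurable (C ^ 2) (ae_of_all _ fun x => by
        rw [Real.norm_eq_abs, abs_pow]; exact pow_le_pow_left₀ (abs_nonneg _) (hC _) 2)
    have h1 : ∫ x, g x ∂(Measure.pi μ) = ∫ x, ∫ y, g (e (x, y)) ∂π ∂(μ 0) := by
      rw [← integral_prod _ hgi]
      exact (hmp.integral_comp' g).symm
    have h2 : ∫ x, g x ^ 2 ∂(Measure.pi μ) = ∫ x, ∫ y, g (e (x, y)) ^ 2 ∂π ∂(μ 0) := by
      rw [← integral_prod _ hg2i]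
      exact (hmp.integral_comp' fun x => g x ^ 2).symm
    -- Total variance: given the first coordinate, induction bounds the variance by n b²; the
    -- conditional mean h oscillates by at most b and adds one more b².
    set h : E → ℝ := fun x => ∫ y, g (e (x, y)) ∂π with hh
    have hhm : Measurable h := (StronglyMeasurable.integral_prod_right'
      hgm.stronglyMeasurable).measurable
    have hgxi : ∀ x, Integrable (fun y => g (e (x, y))) π := fun x =>
      Integrable.of_bound (hgm.comp measurable_prodMk_left).aestronglyMeasurable C
        (ae_of_all _ fun _ => hC _)
    have hhC : ∀ x, |h x| ≤ C := fun x => by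
      have := norm_integral_le_of_norm_le_const (μ := π) (f := fun y => g (e (x, y)))
        (ae_of_all _ fun _ => hC _)
      rwa [probReal_univ, mul_one] at this
    have hhb : ∀ x x', |h x - h x'| ≤ b := fun x x' => by
      rw [hh, ← integral_sub (hgxi x) (hgxi x')]
      have := norm_integral_le_of_norm_le_const (μ := π) (C := b)
        (f := fun y => g (e (x, y)) - g (e (x', y))) (ae_of_all _ fun y => by
          have h3 : e (x, y) = Function.update (e (x', y)) 0 x := by
            rw [hcons, hcons, Fin.update_cons_zero]
          rw [h3]
          exact hb _ _ _)
      rwa [probReal_univ, mul_one] at this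
    have hin : ∀ x, ∫ y, g (e (x, y)) ^ 2 ∂π ≤ h x ^ 2 + n * b ^ 2 := fun x => by
      refine ih (fun j => μ (Fin.succAbove 0 j)) (g := fun y => g (e (x, y)))
        (hgm.comp measurable_prodMk_left) (fun _ => hC _) fun y i a => ?_
      have h3 : e (x, Function.update y i a) = Function.update (e (x, y)) (Fin.succ i) a := by
        rw [hcons, hcons, Fin.cons_update]
      rw [h3]
      exact hb _ _ _
    have hh2i : Integrable (fun x => h x ^ 2) (μ 0) :=
      Integrable.of_bound (hhm.pow_const 2).aestronglyMeasurable (C ^ 2) (ae_of_all _ fun x => by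
        rw [Real.norm_eq_abs, abs_pow]; exact pow_le_pow_left₀ (abs_nonneg _) (hhC _) 2)
    have h4 := integral_sq_le_of_abs_sub_le (μ 0) hhm hhC hhb
    rw [h1, h2]
    calc _ ≤ ∫ x, (h x ^ 2 + n * b ^ 2) ∂(μ 0) :=
          integral_mono hg2i.integral_prod_left (hh2i.add (integrable_const _)) hin
      _ = (∫ x, h x ^ 2 ∂(μ 0)) + n * b ^ 2 := by
          rw [integral_add hh2i (integrable_const _)]; simp
      _ ≤ _ := by push_cast; linarith

/-! ### The logistic flow as a supersolution. -/

/-- The solution at time `τ` of the logistic equation `y' = c y (1 - y / K)`, `y 0 = m`. -/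
noncomputable def logistic (K c m τ : ℝ) : ℝ :=
  K * m * Real.exp (c * τ) / (K + m * (Real.exp (c * τ) - 1))

noncomputable def logisticDeriv (K c m τ : ℝ) : ℝ :=
  c * (K * m * (K - m) * Real.exp (c * τ)) / (K + m * (Real.exp (c * τ) - 1)) ^ 2

section Logistic

variable {K c m : ℝ}

lemma logistic_denom_pos {u : ℝ} (hu : 0 < u) (hK : 0 < K) (hm : 0 ≤ m) (hmK : m ≤ K) :
    0 < K + m * (u - 1) := by
  rcases hm.eq_or_lt with rfl | h
  · simpa using hK
  · have := mul_pos h hu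
    linarith

lemma hasDerivAt_logistic (hK : 0 < K) (hm : 0 ≤ m) (hmK : m ≤ K) (τ : ℝ) :
    HasDerivAt (logistic K c m) (logisticDeriv K c m τ) τ := by
  have hE : HasDerivAt (fun τ => Real.exp (c * τ)) (Real.exp (c * τ) * (c * 1)) τ :=
    ((hasDerivAt_id τ).const_mul c).exp
  have hpos := logistic_denom_pos (Real.exp_pos (c * τ)) hK hm hmK
  refine ((hE.const_mul (K * m)).div (((hE.sub_const 1).const_mul m).const_add K)
    hpos.ne').congr_deriv ?_
  rw [logisticDeriv]
  congr 1
  ring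

lemma continuous_logisticDeriv (hK : 0 < K) (hm : 0 ≤ m) (hmK : m ≤ K) :
    Continuous (logisticDeriv K c m) := by
  unfold logisticDeriv
  refine Continuous.div (by fun_prop) (by fun_prop) fun τ => ?_
  exact pow_ne_zero 2 (logistic_denom_pos (Real.exp_pos (c * τ)) hK hm hmK).ne'

lemma logistic_zero (hK : 0 < K) : logistic K c m 0 = m := by
  simp [logistic, hK.ne']

lemma le_logistic (hK : 0 < K) (hc : 0 ≤ c) (hm : 0 ≤ m) (hmK : m ≤ K) {τ : ℝ} (hτ : 0 ≤ τ) :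
    m ≤ logistic K c m τ := by
  rw [logistic, le_div_iff₀ (logistic_denom_pos (Real.exp_pos _) hK hm hmK)]
  have hu : 1 ≤ Real.exp (c * τ) := Real.one_le_exp (by positivity)
  nlinarith [mul_nonneg (mul_nonneg hm (sub_nonneg.2 hmK)) (sub_nonneg.2 hu)]

/-- The tangent inequality for the logistic flow, which is concave in the initial value. -/
lemma logistic_le_tangent (hK : 0 < K) (hc : 0 ≤ c) (hm : 0 ≤ m) {m' d τ : ℝ}
    (hm' : 0 ≤ m') (hd : 0 ≤ d) (hle : m' ≤ m + d) (hτ : 0 ≤ τ) :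
    logistic K c m' τ ≤ logistic K c m τ +
      d * (K ^ 2 * Real.exp (c * τ) / (K + m * (Real.exp (c * τ) - 1)) ^ 2) := by
  have hu : 1 ≤ Real.exp (c * τ) := Real.one_le_exp (by positivity)
  unfold logistic
  generalize Real.exp (c * τ) = u at *
  have hu1 : 0 ≤ u - 1 := sub_nonneg.2 hu
  have hA : 0 < K + m * (u - 1) := by positivity
  have hA' : 0 < K + m' * (u - 1) := by positivity
  -- The slope of the chord from m to m' differs from the tangent slope at m only in one denominator
  -- factor, which is larger for m' ≥ m. Neither m' nor m + d has to stay below K; m + d may well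
  -- exceed it, since d will be a crude count of pairs.
  have hdiff : K * m' * u / (K + m' * (u - 1)) - K * m * u / (K + m * (u - 1)) =
      (m' - m) * (K ^ 2 * u / ((K + m' * (u - 1)) * (K + m * (u - 1)))) := by
    field_simp
    ring
  have hu0 : 0 < u := by linarith
  suffices h : (m' - m) * (K ^ 2 * u / ((K + m' * (u - 1)) * (K + m * (u - 1)))) ≤
      d * (K ^ 2 * u / (K + m * (u - 1)) ^ 2) by linarith
  rcases le_total m' m with h | h
  · exact (mul_nonpos_of_nonpos_of_nonneg (by linarith) (by positivity)).trans (by positivity)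
  · refine mul_le_mul (by linarith) ?_ (by positivity) hd
    refine div_le_div_of_nonneg_left (by positivity) (by positivity) ?_
    rw [sq]
    gcongr

lemma logistic_mono (hK : 0 < K) (hc : 0 ≤ c) (hm : 0 ≤ m) {m' τ : ℝ} (hm' : 0 ≤ m')
    (hle : m' ≤ m) (hτ : 0 ≤ τ) : logistic K c m' τ ≤ logistic K c m τ := by
  simpa using logistic_le_tangent (d := 0) hK hc hm hm' le_rfl (by simpa using hle) hτ

/-- The mean growth condition under which the logistic flow is a supersolution. -/
lemma logistic_add_mul_le (hm : 0 ≤ m) (hmK : m ≤ K) {δ θ r τ : ℝ} (hθ : 0 < θ) (hK : 1 < K)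
    (hδ : δ ≤ r * (m * (K - m)) / (K * (K - 1))) (hc : θ * r ≤ c * (K - 1)) :
    logistic K c m τ + δ * (K ^ 2 * Real.exp (c * τ) / (K + m * (Real.exp (c * τ) - 1)) ^ 2) ≤
      logistic K c m τ + logisticDeriv K c m τ / θ := by
  have hA := logistic_denom_pos (Real.exp_pos (c * τ)) (by linarith : 0 < K) hm hmK
  have hu := Real.exp_pos (c * τ)
  have hK1 : 0 < K - 1 := by linarith
  have hK0 : 0 < K := by linarith
  unfold logisticDeriv
  generalize Real.exp (c * τ) = u at *
  -- The flow transports its own vector field: its time derivative is its derivative in m times the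
  -- initial speed cm(K-m)/K. Hence only θδ has to be compared with that speed.
  have h1 : θ * δ * K ≤ c * (m * (K - m)) := by
    calc θ * δ * K ≤ θ * (r * (m * (K - m)) / (K * (K - 1))) * K := by gcongr
      _ = θ * r / (K - 1) * (m * (K - m)) := by field_simp
      _ ≤ c * (m * (K - m)) := by
        have : 0 ≤ m * (K - m) := mul_nonneg hm (by linarith)
        refine mul_le_mul_of_nonneg_right ?_ this
        rwa [div_le_iff₀ hK1]
  have h2 : δ * (K ^ 2 * u / (K + m * (u - 1)) ^ 2) =
      (θ * δ * K) * (K * u / ((K + m * (u - 1)) ^ 2 * θ)) := by field_simp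
  have h3 : c * (K * m * (K - m) * u) / (K + m * (u - 1)) ^ 2 / θ =
      (c * (m * (K - m))) * (K * u / ((K + m * (u - 1)) ^ 2 * θ)) := by field_simp
  rw [h2, h3]
  gcongr

end Logistic

/-! ### The energy of the logistic flow, and the explicit bound. -/

/-- `K / c` times this function of the time `τ` is the integral of `logistic K c 1 ^ 2`. -/
noncomputable def logisticEnergy (K c τ : ℝ) : ℝ :=
  K * Real.log ((K + Real.exp (c * τ) - 1) / K) -
    (K - 1) * (Real.exp (c * τ) - 1) / (K + Real.exp (c * τ) - 1)

section Energy

variable {K c : ℝ}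

lemma hasDerivAt_logisticEnergy (hK : 1 ≤ K) (τ : ℝ) :
    HasDerivAt (logisticEnergy K c) (c / K * logistic K c 1 τ ^ 2) τ := by
  have hE : HasDerivAt (fun τ => Real.exp (c * τ)) (Real.exp (c * τ) * (c * 1)) τ :=
    ((hasDerivAt_id τ).const_mul c).exp
  have hu := Real.exp_pos (c * τ)
  have hpos : 0 < K + Real.exp (c * τ) - 1 := by linarith
  have hd := (hE.const_add K).sub_const 1
  refine (((hd.div_const K).log (by positivity)).const_mul K |>.sub
    (((hE.sub_const 1).const_mul (K - 1)).div hd hpos.ne')).congr_deriv ?_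
  unfold logistic
  rw [show K + 1 * (Real.exp (c * τ) - 1) = K + Real.exp (c * τ) - 1 by ring]
  generalize Real.exp (c * τ) = u at *
  field_simp
  ring

lemma continuous_logistic_one (hK : 1 ≤ K) : Continuous (logistic K c 1) :=
  continuous_iff_continuousAt.2 fun τ =>
    (hasDerivAt_logistic (by linarith) zero_le_one hK τ).continuousAt

lemma logisticEnergy_zero (hK : 1 ≤ K) : logisticEnergy K c 0 = 0 := by
  have : K ≠ 0 := by linarith
  simp [logisticEnergy, this]

lemma logisticEnergy_nonneg (hK : 1 ≤ K) (hc : 0 ≤ c) {τ : ℝ} (hτ : 0 ≤ τ) :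
    0 ≤ logisticEnergy K c τ := by
  have hmono : Monotone (logisticEnergy K c) :=
    monotone_of_hasDerivAt_nonneg (hasDerivAt_logisticEnergy hK) fun τ => by
      simp only [Pi.zero_apply]; positivity
  simpa [logisticEnergy_zero hK] using hmono hτ

/-- Writing y for the flow from 1 and E for its energy, y' = cy(1-y/K) and E' = cy²/K give (2E -
y²/K)' = 2cy³/K² ≥ 0, and 2E - y²/K starts at -1/K. -/
lemma logistic_sq_le (hK : 1 ≤ K) (hc : 0 ≤ c) {τ : ℝ} (hτ : 0 ≤ τ) :
    logistic K c 1 τ ^ 2 / K ≤ 1 / K + 2 * logisticEnergy K c τ := by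
  have hK0 : 0 < K := by linarith
  have hd : ∀ τ, HasDerivAt (fun τ => 2 * logisticEnergy K c τ - logistic K c 1 τ ^ 2 / K)
      (2 * (c / K * logistic K c 1 τ ^ 2) -
        (2 : ℕ) * logistic K c 1 τ ^ (2 - 1) * logisticDeriv K c 1 τ / K) τ := fun τ =>
    ((hasDerivAt_logisticEnergy hK τ).const_mul 2).sub
      (((hasDerivAt_logistic hK0 zero_le_one hK τ).pow 2).div_const K)
  have hmono : Monotone (fun τ => 2 * logisticEnergy K c τ - logistic K c 1 τ ^ 2 / K) := by
    refine monotone_of_hasDerivAt_nonneg hd fun τ => ?_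
    have hu := Real.exp_pos (c * τ)
    have hpos := logistic_denom_pos hu hK0 zero_le_one hK
    simp only [Pi.zero_apply]
    unfold logistic logisticDeriv
    generalize Real.exp (c * τ) = u at *
    have : 2 * (c / K * (K * 1 * u / (K + 1 * (u - 1))) ^ 2) -
        (2 : ℕ) * (K * 1 * u / (K + 1 * (u - 1))) ^ (2 - 1) *
          (c * (K * 1 * (K - 1) * u) / (K + 1 * (u - 1)) ^ 2) / K =
        2 * c * K * u ^ 3 / (K + 1 * (u - 1)) ^ 3 := by
      norm_num
      norm_num at hpos
      field_simp
      ring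
    rw [this]
    positivity
  have h := hmono hτ
  simp only [logisticEnergy_zero hK, logistic_zero hK0] at h
  norm_num at h ⊢
  linarith

end Energy

/-- With E the energy, the left side is at most 1/N + (2 + λ/c)E. Here λ/c ≤ 1, and the prefactor in
`chaosBound` is at least 3. -/
lemma logistic_sq_add_energy_le_chaosBound {N D : ℕ} (hD : 1 ≤ D) (hDN : D < N) {lam : ℝ}
    (hlam : 0 < lam) {t : ℝ} (ht : 0 ≤ t) {c : ℝ}
    (hc : c = 2 ^ (D - 1) * lam * D * N / ((N : ℝ) - D)) :
    logistic N c 1 t ^ 2 / N + lam / c * logisticEnergy N c t ≤ chaosBound N D lam t := by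
  have hN : (1 : ℝ) ≤ N := by exact_mod_cast (hD.trans hDN.le)
  have hD' : (1 : ℝ) ≤ D := by exact_mod_cast hD
  have hND : (0 : ℝ) < N - D := by rw [sub_pos]; exact_mod_cast hDN
  have hc0 : 0 < c := by rw [hc]; positivity
  have hE := logisticEnergy_nonneg hN hc0.le ht
  have h1 := logistic_sq_le hN hc0.le ht
  have hB : chaosBound N D lam t =
      1 / N + 2 * (3 / 2) ^ D * N / ((N : ℝ) - D) * logisticEnergy N c t := by
    rw [chaosBound, uN, ← hc, logisticEnergy]
  have h2 : lam / c ≤ 1 := by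
    rw [div_le_one hc0, hc, le_div_iff₀ hND]
    have hp : (1 : ℝ) ≤ 2 ^ (D - 1) := one_le_pow₀ (by norm_num)
    calc lam * (N - D) ≤ lam * N := by gcongr; linarith
      _ = 1 * lam * 1 * N := by ring
      _ ≤ 2 ^ (D - 1) * lam * D * N := by gcongr
  have h3 : 3 ≤ 2 * (3 / 2 : ℝ) ^ D * N / ((N : ℝ) - D) := by
    rw [le_div_iff₀ hND]
    have hp : (3 / 2 : ℝ) ≤ (3 / 2) ^ D := le_self_pow₀ (by norm_num) (by omega)
    calc 3 * ((N : ℝ) - D) ≤ 3 * N := by linarith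
      _ = 2 * (3 / 2) * N := by ring
      _ ≤ 2 * (3 / 2) ^ D * N := by gcongr
  rw [hB]
  have h4 := mul_le_mul_of_nonneg_right h2 hE
  have h5 := mul_le_mul_of_nonneg_right h3 hE
  linarith

/-- Both terms in the bracket tend to u - 1, where u is the limit of `uN`, so they cancel, while the
prefactor stays bounded. -/
theorem tendsto_chaosBound (D : ℕ) (lam t : ℝ) :
    Tendsto (fun M : ℕ => chaosBound M D lam t) atTop (𝓝 0) := by
  have hNat : Tendsto (fun M : ℕ => (M : ℝ)) atTop atTop := tendsto_natCast_atTop_atTop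
  have hinv : Tendsto (fun M : ℕ => 1 / (M : ℝ)) atTop (𝓝 0) := tendsto_one_div_atTop_nhds_zero_nat
  have hq : Tendsto (fun M : ℕ => (M : ℝ) / ((M : ℝ) - D)) atTop (𝓝 1) := by
    have h : Tendsto (fun M : ℕ => 1 / (1 - D * (1 / (M : ℝ)))) atTop (𝓝 (1 / (1 - D * 0))) :=
      tendsto_const_nhds.div (tendsto_const_nhds.sub (hinv.const_mul _)) (by simp)
    simp only [mul_zero, sub_zero, div_one] at h
    refine h.congr' ?_
    filter_upwards [eventually_gt_atTop D] with M hM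
    have h1 : (0 : ℝ) < M := by exact_mod_cast (Nat.zero_le D).trans_lt hM
    have h2 : (0 : ℝ) < M - D := by rw [sub_pos]; exact_mod_cast hM
    have h3 : 1 - (D : ℝ) * (1 / M) ≠ 0 := by
      have : 1 - (D : ℝ) * (1 / M) = (M - D) / M := by field_simp
      rw [this]; positivity
    field_simp
  set u : ℝ := Real.exp (2 ^ (D - 1) * lam * D * t) with hu
  have huN : Tendsto (fun M : ℕ => uN M D lam t) atTop (𝓝 u) := by
    have h : Tendsto (fun M : ℕ => Real.exp (2 ^ (D - 1) * lam * D * ((M : ℝ) / ((M : ℝ) - D)) * t))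
        atTop (𝓝 (Real.exp (2 ^ (D - 1) * lam * D * 1 * t))) :=
      (Real.continuous_exp.tendsto _).comp ((hq.const_mul _).mul_const t)
    rw [mul_one] at h
    refine h.congr fun M => ?_
    rw [uN, mul_div_assoc]
  have hlog : Tendsto (fun M : ℕ => (M : ℝ) * Real.log ((M + uN M D lam t - 1) / M)) atTop
      (𝓝 (u - 1)) := by
    have h := Real.tendsto_nat_mul_log_one_add_of_tendsto (t := u - 1)
      (g := fun M : ℕ => (uN M D lam t - 1) / M) (by
        refine (huN.sub_const 1).congr' ?_
        filter_upwards [eventually_gt_atTop 0] with M hM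
        have : (M : ℝ) ≠ 0 := by exact_mod_cast hM.ne'
        field_simp)
    refine h.congr' ?_
    filter_upwards [eventually_gt_atTop 0] with M hM
    have : (M : ℝ) ≠ 0 := by exact_mod_cast hM.ne'
    congr 2
    field_simp
    ring
  have hfrac : Tendsto (fun M : ℕ => ((M : ℝ) - 1) * (uN M D lam t - 1) / (M + uN M D lam t - 1))
      atTop (𝓝 (u - 1)) := by
    have h : Tendsto (fun M : ℕ => (1 - 1 / (M : ℝ)) * (uN M D lam t - 1) /
        (1 + (uN M D lam t - 1) * (1 / M))) atTop
        (𝓝 ((1 - 0) * (u - 1) / (1 + (u - 1) * 0))) :=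
      ((tendsto_const_nhds.sub hinv).mul (huN.sub_const 1)).div
        (tendsto_const_nhds.add ((huN.sub_const 1).mul hinv)) (by simp)
    simp only [sub_zero, one_mul, mul_zero, add_zero, div_one] at h
    refine h.congr' ?_
    filter_upwards [eventually_gt_atTop 0] with M hM
    have h0 : (1 : ℝ) ≤ M := by exact_mod_cast hM
    have hup : 0 < uN M D lam t := Real.exp_pos _
    have h1 : (M : ℝ) + uN M D lam t - 1 ≠ 0 := by linarith
    have h2 : 1 + (uN M D lam t - 1) * (1 / (M : ℝ)) = (M + uN M D lam t - 1) / M := by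
      field_simp; ring
    rw [h2]
    field_simp
  have hpre : Tendsto (fun M : ℕ => 2 * (3 / 2 : ℝ) ^ D * (M : ℝ) / ((M : ℝ) - D)) atTop
      (𝓝 (2 * (3 / 2) ^ D * 1)) :=
    (hq.const_mul (2 * (3 / 2 : ℝ) ^ D)).congr fun M => (mul_div_assoc _ _ _).symm
  have h := hinv.add (hpre.mul (hlog.sub hfrac))
  simpa [chaosBound] using h

/-! ### Pairs in a sample without replacement. -/

section Sampling

variable {N D : ℕ}

noncomputable def injectiveSamples (N D : ℕ) : Finset (Fin D → Fin N) :=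
  Finset.univ.filter Function.Injective

lemma injectiveSamples_nonempty (hDN : D < N) : (injectiveSamples N D).Nonempty :=
  ⟨Fin.castLE hDN.le, by simp [injectiveSamples, Fin.castLE_injective]⟩

lemma coe_injectiveSamples :
    (injectiveSamples N D : Set (Fin D → Fin N)) = {e | Function.Injective e} := by
  ext e; simp [injectiveSamples]

/-- Symmetry: relabelling the servers by a permutation with i ↦ i', j ↦ j' maps one fibre
injectively into the other. -/
lemma card_injectiveSamples_fiber_le (a b : Fin D) {i j i' j' : Fin N} (h : i ≠ j)
    (h' : i' ≠ j') :
    ((injectiveSamples N D).filter fun e => (e a, e b) = (i, j)).card ≤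
      ((injectiveSamples N D).filter fun e => (e a, e b) = (i', j')).card := by
  -- First i is sent to i', then the image of j to j'. The second swap fixes i', which differs both
  -- from j' and from the image of j.
  set π : Equiv.Perm (Fin N) := Equiv.swap (Equiv.swap i i' j) j' * Equiv.swap i i'
  have h1 : i' ≠ Equiv.swap i i' j := fun hh => h (by
    have := congrArg (Equiv.swap i i') hh
    rwa [Equiv.swap_apply_right, Equiv.swap_apply_self] at this)
  have hi : π i = i' := by
    simp only [π, Equiv.Perm.mul_apply, Equiv.swap_apply_left]
    exact Equiv.swap_apply_of_ne_of_ne h1 h'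
  have hj : π j = j' := by simp [π, Equiv.Perm.mul_apply]
  refine Finset.card_le_card_of_injOn (fun e => π ∘ e) (fun e he => ?_) fun e _ e' _ hee =>
    (π.injective.comp_left) hee
  simp only [injectiveSamples, Finset.coe_filter, Finset.mem_filter, Finset.mem_univ, true_and,
    Set.mem_ofPred_eq, Prod.mk.injEq, Function.comp_apply] at he ⊢
  exact ⟨π.injective.comp he.1, by rw [he.2.1, hi], by rw [he.2.2, hj]⟩

/-- The pair (e a, e b) is uniform on the off-diagonal pairs, and |I|(N - |I|) of them cross from
outside to inside I. -/
lemma card_injectiveSamples_cut {a b : Fin D} (hab : a ≠ b) (I : Finset (Fin N)) :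
    N * (N - 1) * ((injectiveSamples N D).filter fun e => e a ∉ I ∧ e b ∈ I).card =
      I.card * (N - I.card) * (injectiveSamples N D).card := by
  have hconst : ∃ c0, ∀ p ∈ (Finset.univ : Finset (Fin N)).offDiag,
      ((injectiveSamples N D).filter fun e => (e a, e b) = p).card = c0 := by
    rcases (Finset.univ : Finset (Fin N)).offDiag.eq_empty_or_nonempty with h | ⟨p0, hp0⟩
    · exact ⟨0, by simp [h]⟩
    · refine ⟨_, fun p hp => le_antisymm (card_injectiveSamples_fiber_le a b (i := p.1) (j := p.2)
        (i' := p0.1) (j' := p0.2) ?_ ?_) (card_injectiveSamples_fiber_le a b ?_ ?_)⟩ <;>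
      simp_all
  obtain ⟨c0, hc0⟩ := hconst
  have h1 : (injectiveSamples N D).card = N * (N - 1) * c0 := by
    rw [Finset.card_eq_sum_card_fiberwise (f := fun e => (e a, e b))
      (t := (Finset.univ : Finset (Fin N)).offDiag), Finset.sum_congr rfl hc0, Finset.sum_const,
      Finset.offDiag_card]
    · simp [Nat.mul_sub]
    · intro e he
      simp only [injectiveSamples, Finset.coe_filter, Finset.mem_univ, true_and,
        Set.mem_ofPred_eq] at he
      simpa using fun hh => hab (he hh)
  have h2 : ((injectiveSamples N D).filter fun e => e a ∉ I ∧ e b ∈ I).card =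
      (N - I.card) * I.card * c0 := by
    rw [Finset.card_eq_sum_card_fiberwise (f := fun e => (e a, e b)) (t := Iᶜ ×ˢ I)]
    · have : ∀ p ∈ Iᶜ ×ˢ I, (((injectiveSamples N D).filter fun e => e a ∉ I ∧ e b ∈ I).filter
          fun e => (e a, e b) = p).card = c0 := by
        intro p hp
        simp only [Finset.mem_product, Finset.mem_compl] at hp
        rw [← hc0 p (by
          simp only [Finset.mem_offDiag, Finset.mem_univ, true_and]
          exact fun hh => hp.1 (hh ▸ hp.2)), Finset.filter_filter]
        congr 1
        refine Finset.filter_congr fun e _ => ⟨fun h => h.2, fun h => ⟨?_, h⟩⟩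
        rw [← h] at hp
        exact hp
      rw [Finset.sum_congr rfl this, Finset.sum_const, Finset.card_product, Finset.card_compl]
      simp
    · intro e he
      simpa using (Finset.mem_filter.1 he).2
  rw [h1, h2]
  ring

/-- The number of pairs in the sample `e` with first member outside and second one inside `I`. -/
noncomputable def cutPairs (I : Finset (Fin N)) (e : Fin D → Fin N) : ℝ :=
  ∑ a, ∑ b, if e a ∉ I ∧ e b ∈ I then 1 else 0

lemma cutPairs_nonneg (I : Finset (Fin N)) (e : Fin D → Fin N) : 0 ≤ cutPairs I e :=
  Finset.sum_nonneg fun _ _ => Finset.sum_nonneg fun _ _ => by split_ifs <;> simp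

lemma uniformOn_injective_real (p : (Fin D → Fin N) → Prop) [DecidablePred p] :
    (uniformOn {e : Fin D → Fin N | Function.Injective e}).real {e | p e} =
      ((injectiveSamples N D).filter p).card / (injectiveSamples N D).card := by
  have h : ({e | p e} : Set (Fin D → Fin N)) = ((Finset.univ.filter p : Finset _) : Set _) := by
    ext; simp
  rw [measureReal_def, ← coe_injectiveSamples, h, uniformOn_apply_finset]
  rw [ENNReal.toReal_div]
  congr 3
  simp [Finset.inter_filter]

lemma isProbabilityMeasure_uniformOn_injective (hDN : D < N) :
    IsProbabilityMeasure (uniformOn {e : Fin D → Fin N | Function.Injective e}) := by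
  rw [← coe_injectiveSamples]
  exact isProbabilityMeasure_uniformOn (Finset.finite_toSet _) (injectiveSamples_nonempty hDN)

/-- Linearity over the D(D-1) ordered pairs of distinct draws, each crossing with probability |I|(N
- |I|)/(N(N - 1)). -/
lemma integral_cutPairs (hD : 1 ≤ D) (hDN : D < N) (I : Finset (Fin N)) :
    ∫ e, cutPairs I e ∂(uniformOn {e : Fin D → Fin N | Function.Injective e}) =
      D * (D - 1) * (I.card * (N - I.card)) / (N * (N - 1)) := by
  have := isProbabilityMeasure_uniformOn_injective hDN
  set U := uniformOn {e : Fin D → Fin N | Function.Injective e}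
  have hN : (1 : ℝ) < N := by exact_mod_cast hD.trans_lt hDN
  have hpos : (0 : ℝ) < (injectiveSamples N D).card := by
    exact_mod_cast (injectiveSamples_nonempty hDN).card_pos
  have hI : I.card ≤ N := by simpa using I.card_le_univ
  have hab : ∀ a b : Fin D, ∫ e, (if e a ∉ I ∧ e b ∈ I then (1 : ℝ) else 0) ∂U =
      if a = b then 0 else I.card * ((N : ℝ) - I.card) / (N * (N - 1)) := by
    intro a b
    have h1 : ∫ e, (if e a ∉ I ∧ e b ∈ I then (1 : ℝ) else 0) ∂U =
        U.real {e | e a ∉ I ∧ e b ∈ I} := by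
      rw [← integral_indicator_one (Set.toFinite _).measurableSet]
      refine integral_congr_ae (ae_of_all _ fun e => ?_)
      simp [Set.indicator_apply]
    rw [h1, uniformOn_injective_real]
    split_ifs with h
    · subst h; simp
    · have h2 := card_injectiveSamples_cut (N := N) h I
      have h3 : (N : ℝ) * (N - 1) *
          ((injectiveSamples N D).filter fun e => e a ∉ I ∧ e b ∈ I).card =
          I.card * (N - I.card) * (injectiveSamples N D).card := by
        have : 1 ≤ N := by omega
        have h4 := congrArg (Nat.cast : ℕ → ℝ) h2
        push_cast [Nat.cast_sub hI, Nat.cast_sub this] at h4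
        exact h4
      have hN1 : (0 : ℝ) < N - 1 := by linarith
      rw [div_eq_div_iff hpos.ne' (by positivity)]
      linarith
  unfold cutPairs
  rw [integral_finsetSum _ fun a _ => Integrable.of_finite]
  simp_rw [integral_finsetSum Finset.univ fun b _ => Integrable.of_finite, hab]
  have : ∀ a : Fin D, ∑ b : Fin D, (if a = b then 0 else
      I.card * ((N : ℝ) - I.card) / (N * (N - 1))) =
      (D - 1) * (I.card * ((N : ℝ) - I.card) / (N * (N - 1))) := by
    intro a
    rw [Finset.sum_ite, Finset.sum_const_zero, zero_add, Finset.sum_const, Finset.filter_ne,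
      Finset.card_erase_of_mem (Finset.mem_univ _), Finset.card_univ, Fintype.card_fin,
      nsmul_eq_mul, Nat.cast_sub hD]
    simp
  simp_rw [this]
  simp only [Finset.sum_const, Finset.card_univ, Fintype.card_fin, nsmul_eq_mul]
  ring

end Sampling

/-! ### Measurable states of a server. -/

/-- The information on the past of a server which determines its future: the number of jobs
offered so far, and the jobs. -/
abbrev ServerState : Type := ℕ × (ℕ → Job)

noncomputable def ServerState.push (q : ServerState) (a : Job) : ServerState :=
  (q.1 + 1, Function.update q.2 q.1 a)

/-- Padding with 0 makes equal lists give equal states in one fixed measurable space, so that states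
can be compared and updated coordinatewise. -/
noncomputable def ServerState.ofList (l : List Job) : ServerState :=
  (l.length, fun j => l.getD j 0)

lemma ServerState.ofList_append (l : List Job) (a : Job) :
    ofList (l ++ [a]) = (ofList l).push a := by
  refine Prod.ext (by simp [ofList, push]) (funext fun j => ?_)
  simp only [ofList, push, Function.update_apply, List.getD_eq_getElem?_getD]
  rcases lt_trichotomy j l.length with h | h | h
  · simp [List.getElem?_append_left h, h.ne]
  · simp [h]
  · rw [List.getElem?_eq_none (by simp; omega), List.getElem?_eq_none (by omega), if_neg h.ne']

lemma measurable_push : Measurable fun p : ServerState × Job => p.1.push p.2 := by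
  refine (measurable_fst.fst.add_const 1).prodMk (measurable_pi_lambda _ fun j => ?_)
  simp only [Function.update_apply]
  refine Measurable.ite ?_ measurable_snd ((measurable_pi_apply j).comp measurable_fst.snd)
  exact measurableSet_eq_fun measurable_const measurable_fst.fst

noncomputable def WorkConservingDiscipline.queue (disc : WorkConservingDiscipline)
    (q : ServerState) (t : ℝ) : ℕ :=
  disc.numJobs (fun j : Fin q.1 => q.2 j) t

lemma WorkConservingDiscipline.numJobs_get (disc : WorkConservingDiscipline) (l : List Job)
    (t : ℝ) : disc.numJobs l.get t = disc.queue (ServerState.ofList l) t := by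
  change _ = disc.numJobs (fun j : Fin l.length => l.getD j 0) t
  congr 1
  ext j : 1
  simp

lemma WorkConservingDiscipline.measurable_numJobs (disc : WorkConservingDiscipline) (n : ℕ) :
    Measurable fun p : (Fin n → Job) × ℝ => disc.numJobs p.1 p.2 := by
  simp only [numJobs, Finset.card_filter]
  refine Finset.measurable_sum _ fun j _ => Measurable.ite ?_ measurable_const measurable_const
  have hj : Measurable fun p : (Fin n → Job) × ℝ => p.1 j :=
    (measurable_pi_apply j).comp measurable_fst
  exact (measurableSet_le hj.fst measurable_snd).inter
    (measurableSet_lt (disc.measurable_service j) hj.snd.fst)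

lemma WorkConservingDiscipline.measurable_queue (disc : WorkConservingDiscipline) :
    Measurable fun p : ServerState × ℝ => disc.queue p.1 p.2 := by
  have h : Measurable fun p : ((ℕ → Job) × ℝ) × ℕ =>
      disc.numJobs (fun j : Fin p.2 => p.1.1 j) p.1.2 := by
    refine measurable_from_prod_countable_left fun n => ?_
    refine (disc.measurable_numJobs n).comp (Measurable.prodMk ?_ measurable_snd)
    exact measurable_pi_lambda _ fun j => (measurable_pi_apply _).comp measurable_fst
  exact h.comp ((measurable_fst.snd.prodMk measurable_snd).prodMk measurable_fst.fst)

/-! ### Routing and the coupling of two systems. -/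

section Routing

variable {N D : ℕ}

lemma JoinsServer.eq {q : Fin N → ℕ} {e : Fin D → Fin N} {i i' : Fin N}
    (h : JoinsServer q e i) (h' : JoinsServer q e i') : i = i' := by
  obtain ⟨r, rfl, hr, hr'⟩ := h
  obtain ⟨s, rfl, hs, hs'⟩ := h'
  rcases lt_trichotomy r s with hrs | rfl | hrs
  · exact absurd (hs' r hrs) (not_lt.2 (hr s))
  · rfl
  · exact absurd (hr' s hrs) (not_lt.2 (hs r))

lemma joinsServer_congr {q q' : Fin N → ℕ} {e : Fin D → Fin N} (h : ∀ r, q (e r) = q' (e r))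
    (i : Fin N) : JoinsServer q e i ↔ JoinsServer q' e i := by
  simp only [JoinsServer, h]

/-- The state of the system after the arrival at time `r` of a task with sample `z.1` and service
data `z.2`. -/
noncomputable def routeJob (disc : WorkConservingDiscipline) (q : Fin N → ServerState) (r : ℝ)
    (z : (Fin D → Fin N) × ℝ × ℝ) : Fin N → ServerState :=
  fun i => if JoinsServer (fun i' => disc.queue (q i') r) z.1 i then (q i).push (r, z.2) else q i

lemma measurable_routeJob (disc : WorkConservingDiscipline) :
    Measurable fun p : (Fin N → ServerState) × ℝ × ((Fin D → Fin N) × ℝ × ℝ) =>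
      routeJob disc p.1 p.2.1 p.2.2 := by
  refine measurable_pi_lambda _ fun i => ?_
  have hi : ∀ i, Measurable fun p : (Fin N → ServerState) × ℝ × ((Fin D → Fin N) × ℝ × ℝ) =>
      p.1 i := fun i => (measurable_pi_apply i).comp measurable_fst
  refine Measurable.ite ?_ ?_ (hi i)
  · have h : Measurable fun p : (Fin N → ServerState) × ℝ × ((Fin D → Fin N) × ℝ × ℝ) =>
        ((fun i' => disc.queue (p.1 i') p.2.1, p.2.2.1) : (Fin N → ℕ) × (Fin D → Fin N)) :=
      (measurable_pi_lambda _ fun i' => disc.measurable_queue.comp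
        ((hi i').prodMk measurable_snd.fst)).prodMk measurable_snd.snd.fst
    exact h (MeasurableSet.of_discrete (s := {x : (Fin N → ℕ) × (Fin D → Fin N) |
      JoinsServer x.1 x.2 i}))
  · exact measurable_push.comp ((hi i).prodMk (measurable_snd.fst.prodMk measurable_snd.snd.snd))

/-- The servers at which two states of the system differ. -/
noncomputable def differing (q q' : Fin N → ServerState) : Finset (Fin N) :=
  Finset.univ.filter fun i => q i ≠ q' i

lemma card_differing_le (q q' : Fin N → ServerState) : ((differing q q').card : ℝ) ≤ N := by
  exact_mod_cast (Finset.card_le_univ _).trans_eq (Fintype.card_fin N)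

/-- If the sample misses the differing set, both systems see the same sampled queues and route the
job alike. If it hits the set, new differences can only be sampled servers outside it, and each of
them forms a crossing pair with a sampled server inside. -/
lemma card_differing_routeJob_le (disc : WorkConservingDiscipline) (q q' : Fin N → ServerState)
    (r : ℝ) (z : (Fin D → Fin N) × ℝ × ℝ) :
    ((differing (routeJob disc q r z) (routeJob disc q' r z)).card : ℝ) ≤
      (differing q q').card + cutPairs (differing q q') z.1 := by
  set I := differing q q' with hI
  have hnot : ∀ i, i ∉ I → q i = q' i := fun i hi => by simpa [hI, differing] using hi
  by_cases h : ∃ b, z.1 b ∈ I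
  · obtain ⟨b, hb⟩ := h
    have hsub : differing (routeJob disc q r z) (routeJob disc q' r z) ⊆
        I ∪ (Finset.univ.filter fun a => z.1 a ∉ I).image z.1 := by
      intro i hi
      rw [Finset.mem_union]
      by_contra hcon
      rw [not_or] at hcon
      have hi' : routeJob disc q r z i ≠ routeJob disc q' r z i := by
        simpa [differing] using hi
      refine hi' ?_
      have hnj : ∀ p : Fin N → ℕ, ¬ JoinsServer p z.1 i := by
        rintro p ⟨a, rfl, -⟩
        refine hcon.2 (Finset.mem_image.2 ⟨a, ?_, rfl⟩)
        simpa using hcon.1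
      simp [routeJob, hnj, hnot i hcon.1]
    have h1 : (Finset.univ.filter fun a => z.1 a ∉ I).card ≤ cutPairs I z.1 := by
      rw [Finset.card_filter, Nat.cast_sum, cutPairs]
      refine Finset.sum_le_sum fun a _ => ?_
      by_cases ha : z.1 a ∈ I
      · simp [ha]
      · refine le_trans ?_ (Finset.single_le_sum
          (f := fun b => if z.1 a ∉ I ∧ z.1 b ∈ I then (1 : ℝ) else 0)
          (fun b _ => by split_ifs <;> simp) (Finset.mem_univ b))
        simp [ha, hb]
    calc _ ≤ ((I.card + (Finset.univ.filter fun a => z.1 a ∉ I).card : ℕ) : ℝ) := by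
          exact_mod_cast (Finset.card_le_card hsub).trans
            ((Finset.card_union_le _ _).trans (Nat.add_le_add_left Finset.card_image_le _))
      _ ≤ _ := by push_cast; linarith
  · push Not at h
    have hsub : differing (routeJob disc q r z) (routeJob disc q' r z) ⊆ I := by
      intro i hi
      by_contra hcon
      have hi' : routeJob disc q r z i ≠ routeJob disc q' r z i := by
        simpa [differing] using hi
      refine hi' ?_
      have hj := joinsServer_congr (q := fun i' => disc.queue (q i') r)
        (q' := fun i' => disc.queue (q' i') r) (e := z.1) (fun a => by simp [hnot _ (h a)]) i
      simp only [routeJob, hj, hnot i hcon]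
    have h1 := cutPairs_nonneg I z.1
    have h2 : ((differing (routeJob disc q r z) (routeJob disc q' r z)).card : ℝ) ≤ I.card := by
      exact_mod_cast Finset.card_le_card hsub
    linarith

lemma card_differing_routeJob_self_le (disc : WorkConservingDiscipline)
    (q : Fin N → ServerState) (r : ℝ) (z : (Fin D → Fin N) × ℝ × ℝ) :
    (differing (routeJob disc q r z) q).card ≤ 1 := by
  have hmem : ∀ i ∈ differing (routeJob disc q r z) q,
      JoinsServer (fun i' => disc.queue (q i') r) z.1 i := by
    intro i hi
    by_contra hcon
    simp [differing, routeJob, hcon] at hi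
  exact Finset.card_le_one.2 fun i hi j hj => (hmem i hi).eq (hmem j hj)

/-- The proportion of servers with `k` tasks at time `t`, if there are no further arrivals. -/
noncomputable def terminalProportion (disc : WorkConservingDiscipline) (t : ℝ) (k : ℕ)
    (q : Fin N → ServerState) : ℝ :=
  empiricalMeasure (fun i => disc.queue (q i) t) k

lemma empiricalMeasure_nonneg (x : Fin N → ℕ) (k : ℕ) : 0 ≤ empiricalMeasure x k :=
  div_nonneg (Finset.sum_nonneg fun _ _ => by split_ifs <;> simp) (Nat.cast_nonneg N)

lemma empiricalMeasure_le_one (x : Fin N → ℕ) (k : ℕ) : empiricalMeasure x k ≤ 1 := by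
  refine div_le_one_of_le₀ ?_ (Nat.cast_nonneg N)
  calc ∑ i, (if x i = k then (1 : ℝ) else 0) ≤ ∑ _i : Fin N, (1 : ℝ) :=
        Finset.sum_le_sum fun _ _ => by split_ifs <;> simp
    _ = N := by simp

lemma abs_empiricalMeasure_le (x : Fin N → ℕ) (k : ℕ) : |empiricalMeasure x k| ≤ 1 :=
  abs_le.2 ⟨by linarith [empiricalMeasure_nonneg x k], empiricalMeasure_le_one x k⟩

lemma measurable_empiricalMeasure (k : ℕ) :
    Measurable fun x : Fin N → ℕ => empiricalMeasure x k :=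
  Measurable.of_discrete

lemma measurable_terminalProportion (disc : WorkConservingDiscipline) (t : ℝ) (k : ℕ) :
    Measurable (terminalProportion (N := N) disc t k) :=
  (measurable_empiricalMeasure k).comp (measurable_pi_lambda _ fun i =>
    disc.measurable_queue.comp (f := fun q : Fin N → ServerState => (q i, t))
      ((measurable_pi_apply i).prodMk measurable_const))

lemma abs_terminalProportion_sub_le (disc : WorkConservingDiscipline) (t : ℝ) (k : ℕ)
    (q q' : Fin N → ServerState) :
    |terminalProportion disc t k q - terminalProportion disc t k q'| ≤
      (differing q q').card / N := by
  unfold terminalProportion empiricalMeasure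
  rw [← sub_div, abs_div, Nat.abs_cast, ← Finset.sum_sub_distrib]
  refine div_le_div_of_nonneg_right ?_ (Nat.cast_nonneg N)
  refine (Finset.abs_sum_le_sum_abs _ _).trans ?_
  rw [differing, Finset.card_filter, Nat.cast_sum]
  refine Finset.sum_le_sum fun i _ => ?_
  by_cases h : q i = q' i
  · simp [h]
  · simp only [h, ne_eq, not_false_eq_true, if_true, Nat.cast_one]
    split_ifs <;> simp

/-- The influence of a change of the state of the system on the expected terminal proportions
grows at most logistically. -/
theorem abs_sub_value_le_logistic (hD : 1 ≤ D) (hDN : D < N) {lam c : ℝ} (hlam : 0 < lam)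
    (hc : lam * N * (D * (D - 1)) ≤ c * (N - 1)) {ν' : Measure (ℝ × ℝ)} [IsProbabilityMeasure ν']
    (disc : WorkConservingDiscipline) (t : ℝ) (k n : ℕ) {s : ℝ} (hs : s ≤ t)
    (q q' : Fin N → ServerState) :
    |(jumpOp (routeJob disc) t ((expMeasure (lam * N)).prod
        ((uniformOn {e : Fin D → Fin N | Function.Injective e}).prod ν')))^[n]
          (fun σ => terminalProportion disc t k σ.2) (s, q) -
      (jumpOp (routeJob disc) t ((expMeasure (lam * N)).prod
        ((uniformOn {e : Fin D → Fin N | Function.Injective e}).prod ν')))^[n]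
          (fun σ => terminalProportion disc t k σ.2) (s, q')| ≤
      logistic N c (differing q q').card (t - s) / N := by
  have := isProbabilityMeasure_uniformOn_injective hDN
  set U := uniformOn {e : Fin D → Fin N | Function.Injective e} with hU
  have hN1 : (1 : ℝ) < N := by exact_mod_cast hD.trans_lt hDN
  have hN0 : (0 : ℝ) < N := by linarith
  have hD' : (1 : ℝ) ≤ D := by exact_mod_cast hD
  have hθ : 0 < lam * N := by positivity
  have hc0 : 0 ≤ c := by
    have h1 : 0 ≤ lam * N * (D * ((D : ℝ) - 1)) :=
      mul_nonneg hθ.le (mul_nonneg (by linarith) (by linarith))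
    exact nonneg_of_mul_nonneg_left (h1.trans hc) (by linarith)
  refine abs_iterate_jumpOp_sub_le_of_supersolution
    (Φ := fun q q' τ => logistic N c (differing q q').card τ / N)
    (Φ' := fun q q' τ => logisticDeriv N c (differing q q').card τ / N)
    (measurable_routeJob disc) hθ
    (measurable_terminalProportion disc t k) (C := 1) (fun q => abs_empiricalMeasure_le _ k)
    (fun q q' τ => (hasDerivAt_logistic hN0 (Nat.cast_nonneg _)
      (card_differing_le q q') τ).div_const _)
    (fun q q' => (continuous_logisticDeriv hN0 (Nat.cast_nonneg _)
      (card_differing_le q q')).div_const _)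
    (fun q q' => ?_) (fun q q' τ hτ => ?_) (fun q q' r hr => ?_) n hs q q'
  · rw [logistic_zero hN0]; exact abs_terminalProportion_sub_le disc t k q q'
  · rw [logistic_zero hN0]
    exact div_le_div_of_nonneg_right
      (le_logistic hN0 hc0 (Nat.cast_nonneg _) (card_differing_le q q') hτ) hN0.le
  · set I := differing q q' with hI
    set τ := t - r
    have hτ : 0 ≤ τ := sub_nonneg.2 hr
    set κ := (N : ℝ) ^ 2 * Real.exp (c * τ) / (N + I.card * (Real.exp (c * τ) - 1)) ^ 2
    have hci : Integrable (fun z : (Fin D → Fin N) × ℝ × ℝ => cutPairs I z.1) (U.prod ν') :=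
      (Integrable.of_finite (f := cutPairs I) (μ := U)).comp_fst ν'
    -- The tangent at the current number of differences replaces Jensen's inequality: this majorant
    -- is affine in `cutPairs`, so only the mean of `cutPairs` enters its integral.
    refine ⟨fun z => (logistic N c I.card τ + cutPairs I z.1 * κ) / N,
      ((integrable_const _).add (hci.mul_const κ)).div_const _, fun z => ?_, ?_⟩
    · exact div_le_div_of_nonneg_right (logistic_le_tangent hN0 hc0 (Nat.cast_nonneg _)
        (Nat.cast_nonneg _) (cutPairs_nonneg I z.1) (card_differing_routeJob_le disc q q' r z) hτ)
        hN0.le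
    · have hint : ∫ z, cutPairs I z.1 ∂(U.prod ν') =
          D * (D - 1) * (I.card * (N - I.card)) / (N * (N - 1)) := by
        rw [integral_fun_fst (cutPairs I), integral_cutPairs hD hDN]
        simp
      rw [integral_div, integral_add (integrable_const _) (hci.mul_const κ), integral_mul_const,
        hint, integral_const, probReal_univ, one_smul, div_right_comm, ← add_div]
      refine div_le_div_of_nonneg_right ?_ hN0.le
      exact logistic_add_mul_le (Nat.cast_nonneg _) (card_differing_le q q') hθ hN1 le_rfl hc

end Routing

/-! ### Independence of the next mark from the present state. -/

lemma indepFun_prodMk_left {Ω α β γ : Type*} [MeasurableSpace Ω] [MeasurableSpace α]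
    [MeasurableSpace β] [MeasurableSpace γ] {P : Measure Ω} [IsProbabilityMeasure P]
    {A : Ω → α} {B : Ω → β} {C : Ω → γ} (hA : Measurable A) (hB : Measurable B)
    (hC : Measurable C) (h : IndepFun A (fun ω => (B ω, C ω)) P) (hBC : IndepFun B C P) :
    IndepFun (fun ω => (A ω, B ω)) C P := by
  have hAB : IndepFun A B P := h.comp measurable_id measurable_fst
  have := Measure.isProbabilityMeasure_map (μ := P) hA.aemeasurable
  have := Measure.isProbabilityMeasure_map (μ := P) hB.aemeasurable
  have := Measure.isProbabilityMeasure_map (μ := P) hC.aemeasurable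
  rw [indepFun_iff_map_prod_eq_prod_map_map (hA.prodMk hB).aemeasurable hC.aemeasurable,
    (indepFun_iff_map_prod_eq_prod_map_map hA.aemeasurable hB.aemeasurable).1 hAB]
  rw [indepFun_iff_map_prod_eq_prod_map_map hA.aemeasurable (hB.prodMk hC).aemeasurable,
    (indepFun_iff_map_prod_eq_prod_map_map hB.aemeasurable hC.aemeasurable).1 hBC] at h
  have hassoc := (measurePreserving_prodAssoc (P.map A) (P.map B) (P.map C)).symm
  rw [← hassoc.map_eq, ← h, Measure.map_map (MeasurableEquiv.measurable _)
    (hA.prodMk (hB.prodMk hC))]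
  rfl

/-- The state after n steps is a measurable function of the initial data and of the marks with index
below n. -/
lemma indepFun_chain {Q Z Ω α : Type*} [MeasurableSpace Q] [MeasurableSpace Z]
    [MeasurableSpace Ω] [MeasurableSpace α] {ρ : Q → ℝ → Z → Q} {t : ℝ} {P : Measure Ω}
    [IsProbabilityMeasure P] {σ : ℕ → Ω → ℝ × Q} {M : ℕ → Ω → ℝ × Z} {A : Ω → α}
    (hρ : Measurable fun p : Q × ℝ × Z => ρ p.1 p.2.1 p.2.2)
    (hA : Measurable A) (hM : ∀ n, Measurable (M n))
    (hstep : ∀ n ω, σ (n + 1) ω = jumpStep ρ t (σ n ω) (M n ω))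
    (h0 : ∃ g, Measurable g ∧ ∀ ω, σ 0 ω = g (A ω))
    (hiM : iIndepFun M P) (hAM : IndepFun A (fun ω n => M n ω) P) (n : ℕ) :
    IndepFun (σ n) (M n) P := by
  have hrep : ∀ n, ∃ g : α × (Finset.range n → ℝ × Z) → ℝ × Q, Measurable g ∧
      ∀ ω, σ n ω = g (A ω, fun k => M k ω) := by
    intro n
    induction n with
    | zero =>
      obtain ⟨g, hg, h⟩ := h0
      exact ⟨fun p => g p.1, hg.comp measurable_fst, h⟩
    | succ n ih =>
      obtain ⟨g, hg, h⟩ := ih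
      refine ⟨fun p => jumpStep ρ t (g (p.1, fun k => p.2 ⟨k, Finset.mem_range.2
        ((Finset.mem_range.1 k.2).trans n.lt_succ_self)⟩)) (p.2 ⟨n, Finset.self_mem_range_succ n⟩),
        ?_, fun ω => by rw [hstep, h]⟩
      refine (measurable_jumpStep hρ).comp (Measurable.prodMk (hg.comp (measurable_fst.prodMk
        (measurable_pi_lambda _ fun k => ?_))) ?_)
      · exact (measurable_pi_apply _).comp measurable_snd
      · exact (measurable_pi_apply _).comp measurable_snd
  obtain ⟨g, hg, h⟩ := hrep n
  have hB : Measurable fun ω (k : Finset.range n) => M k ω :=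
    measurable_pi_lambda _ fun k => hM k
  have hBC : IndepFun (fun ω (k : Finset.range n) => M k ω) (M n) P := by
    have h1 := hiM.indepFun_finset (Finset.range n) {n} (by simp) hM
    exact h1.comp measurable_id (measurable_pi_apply (⟨n, by simp⟩ : ({n} : Finset ℕ)))
  have hABC : IndepFun A (fun ω => ((fun k : Finset.range n => M k ω), M n ω)) P := by
    refine hAM.comp (ψ := fun m : ℕ → ℝ × Z => ((fun k : Finset.range n => m k), m n))
      measurable_id ?_
    exact (measurable_pi_lambda _ fun k => measurable_pi_apply _).prodMk (measurable_pi_apply _)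
  have := (indepFun_prodMk_left hA hB (hM n) hABC hBC).comp hg measurable_id
  have hσ : σ n = g ∘ fun ω => (A ω, fun k : Finset.range n => M k ω) := funext h
  rw [hσ]
  exact this

/-! ### The queueing system as a realization of the jump chain. -/

namespace JSQInput

variable {Ω : Type*} [MeasurableSpace Ω] {P : Measure Ω} {N D : ℕ} {lam : ℝ} {G : Measure ℝ}

/-- The states of the servers when the `i`-th one starts with `ξ i` jobs with data `x i`. -/
noncomputable def initialState (ξ : Fin N → ℕ) (x : Fin N → ℕ → ℝ × ℝ) : Fin N → ServerState :=
  fun i => ServerState.ofList ((List.range (ξ i)).map fun m => (0, x i m))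

lemma measurable_initialState (ξ : Fin N → ℕ) : Measurable (initialState ξ) := by
  refine measurable_pi_lambda _ fun i => ?_
  have h : (fun x : Fin N → ℕ → ℝ × ℝ => initialState ξ x i) = fun x =>
      (ξ i, fun j => if j < ξ i then ((0, x i j) : Job) else 0) := by
    funext x
    refine Prod.ext (by simp [initialState, ServerState.ofList]) (funext fun j => ?_)
    by_cases hj : j < ξ i
    · simp [initialState, ServerState.ofList, hj]
    · simp [initialState, ServerState.ofList, hj]
  rw [h]
  refine measurable_const.prodMk (measurable_pi_lambda _ fun j => ?_)
  split_ifs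
  · exact measurable_const.prodMk ((measurable_pi_apply j).comp (measurable_pi_apply i))
  · exact measurable_const

lemma differing_initialState_update (ξ : Fin N → ℕ) (x : Fin N → ℕ → ℝ × ℝ) (i : Fin N)
    (y : ℕ → ℝ × ℝ) :
    (differing (initialState ξ (Function.update x i y)) (initialState ξ x)).card ≤ 1 := by
  have h : ∀ j ∈ differing (initialState ξ (Function.update x i y)) (initialState ξ x), j = i := by
    intro j hj
    by_contra hne
    refine (Finset.mem_filter.1 hj).2 ?_
    have hu : Function.update x i y j = x j := Function.update_of_ne hne _ _
    simp only [initialState, hu]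
  exact Finset.card_le_one.2 fun a ha b hb => (h a ha).trans (h b hb).symm

/-- The jump chain with horizon `t` driven by the arriving tasks. -/
noncomputable def chain (S : JSQInput P N D lam G) (disc : WorkConservingDiscipline)
    (ξ : Fin N → ℕ) (t : ℝ) : ℕ → Ω → ℝ × (Fin N → ServerState)
  | 0 => fun ω => (0, initialState ξ fun i => S.initial i ω)
  | n + 1 => fun ω => jumpStep (routeJob disc) t (chain S disc ξ t n ω) (S.mark n ω)

variable (S : JSQInput P N D lam G) (disc : WorkConservingDiscipline) (ξ : Fin N → ℕ) (t : ℝ)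

lemma chain_succ (n : ℕ) (ω : Ω) : S.chain disc ξ t (n + 1) ω =
    jumpStep (routeJob disc) t (S.chain disc ξ t n ω) (S.mark n ω) := rfl

lemma measurable_chain (n : ℕ) : Measurable (S.chain disc ξ t n) := by
  induction n with
  | zero => exact measurable_const.prodMk ((measurable_initialState ξ).comp
      (measurable_pi_lambda _ fun i => S.measurable_initial i))
  | succ n ih =>
    exact (measurable_jumpStep (measurable_routeJob disc)).comp (ih.prodMk (S.measurable_mark n))

lemma ofList_jobs_succ (ω : Ω) (n : ℕ) :
    (fun i => ServerState.ofList (S.jobs disc ξ ω (n + 1) i)) =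
      routeJob disc (fun i => ServerState.ofList (S.jobs disc ξ ω n i)) (S.arrivalTime n ω)
        (S.mark n ω).2 := by
  funext i
  simp only [jobs, routeJob, disc.numJobs_get]
  split_ifs
  · rw [ServerState.ofList_append]
  · rfl

lemma measurable_arrivalTime (n : ℕ) : Measurable (S.arrivalTime n) :=
  Finset.measurable_sum _ fun m _ => (S.measurable_mark m).fst

lemma measurable_ofList_jobs (n : ℕ) :
    Measurable fun ω i => ServerState.ofList (S.jobs disc ξ ω n i) := by
  induction n with
  | zero =>
    have hi : Measurable fun ω i => S.initial i ω :=
      measurable_pi_lambda _ fun i => S.measurable_initial i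
    exact (measurable_initialState ξ).comp hi
  | succ n ih =>
    have hs : (fun ω i => ServerState.ofList (S.jobs disc ξ ω (n + 1) i)) = fun ω =>
        routeJob disc (fun i => ServerState.ofList (S.jobs disc ξ ω n i)) (S.arrivalTime n ω)
          (S.mark n ω).2 := funext fun ω => S.ofList_jobs_succ disc ξ ω n
    rw [hs]
    exact (measurable_routeJob disc).comp (ih.prodMk ((S.measurable_arrivalTime n).prodMk
      (S.measurable_mark n).snd))

lemma measurable_numArrivals : Measurable (S.numArrivals t) := by
  refine measurable_ncard.comp (measurable_set_iff.2 fun n => ?_)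
  exact measurableSet_setOfPred.1 (measurableSet_le (S.measurable_arrivalTime n) measurable_const)

lemma measurable_queueLength (i : Fin N) :
    Measurable fun ω => S.queueLength disc ξ t ω i := by
  have h : Measurable fun p : Ω × ℕ =>
      disc.queue (ServerState.ofList (S.jobs disc ξ p.1 p.2 i)) t := by
    refine measurable_from_prod_countable_left fun n => ?_
    exact disc.measurable_queue.comp (((measurable_pi_apply i).comp
      (S.measurable_ofList_jobs disc ξ n)).prodMk measurable_const)
  simp only [queueLength, disc.numJobs_get]
  exact h.comp (measurable_id.prodMk (S.measurable_numArrivals t))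

lemma chain_eq (ht : 0 ≤ t) (ω : Ω) (n : ℕ) (h : ∀ m < n, S.arrivalTime m ω ≤ t) :
    S.chain disc ξ t n ω = (∑ m ∈ Finset.range n, (S.mark m ω).1,
      fun i => ServerState.ofList (S.jobs disc ξ ω n i)) := by
  induction n with
  | zero => rfl
  | succ n ih =>
    -- The clock before step n is the arrival time of task n - 1, or 0 if n = 0; in the latter case
    -- `ht` is needed.
    have hn : ∑ m ∈ Finset.range n, (S.mark m ω).1 ≤ t := by
      cases n with
      | zero => simpa using ht
      | succ n => exact h n (by omega)
    have hT : ∑ m ∈ Finset.range n, (S.mark m ω).1 + (S.mark n ω).1 = S.arrivalTime n ω := by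
      rw [arrivalTime, Finset.sum_range_succ]
    rw [chain_succ, ih fun m hm => h m (by omega), jumpStep, if_pos hn]
    simp only [hT]
    rw [if_pos (h n (by omega)), ← ofList_jobs_succ]
    rfl

/-- Beyond the horizon the chain contains the jobs offered by time `t`. -/
lemma chain_terminal (ht : 0 ≤ t) {ω : Ω} (hpos : ∀ n, 0 < (S.mark n ω).1) {n : ℕ}
    (h : t < (S.chain disc ξ t n ω).1) (k : ℕ) :
    terminalProportion disc t k (S.chain disc ξ t n ω).2 =
      empiricalMeasure (S.queueLength disc ξ t ω) k := by
  have hsum : ∀ n, (∀ m < n, S.arrivalTime m ω ≤ t) →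
      ∑ m ∈ Finset.range n, (S.mark m ω).1 ≤ t := by
    intro n hn
    cases n with
    | zero => simpa using ht
    | succ n => exact hn n (by omega)
  have hex : ∃ m, t < S.arrivalTime m ω := by
    by_contra hcon
    push Not at hcon
    rw [chain_eq S disc ξ t ht ω n fun m _ => hcon m] at h
    exact absurd h (not_lt.2 (hsum n fun m _ => hcon m))
  -- K is the first task arriving after t. As arrival times increase, K is also the number of
  -- arrivals by time t. The clock passes t exactly at step K + 1, where task K is not routed.
  set K := Nat.find hex with hK
  have hKt : t < S.arrivalTime K ω := Nat.find_spec hex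
  have hlt : ∀ m < K, S.arrivalTime m ω ≤ t := fun m hm => not_lt.1 (Nat.find_min hex hm)
  have hmono : Monotone fun m => S.arrivalTime m ω := monotone_nat_of_le_succ fun m => by
    simp only [arrivalTime]
    rw [Finset.sum_range_succ _ (m + 1)]
    linarith [hpos (m + 1)]
  have hnum : S.numArrivals t ω = K := by
    have : {n | S.arrivalTime n ω ≤ t} = (Finset.range K : Set ℕ) := by
      ext m
      simp only [Set.mem_ofPred_eq, Finset.coe_range, Set.mem_Iio]
      exact ⟨fun hm => not_le.1 fun hKm => absurd (hmono hKm) (not_le.2 (hm.trans_lt hKt)), hlt m⟩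
    rw [numArrivals, this, Set.ncard_coe_finset, Finset.card_range]
  have hT : ∑ m ∈ Finset.range K, (S.mark m ω).1 + (S.mark K ω).1 = S.arrivalTime K ω := by
    rw [arrivalTime, Finset.sum_range_succ]
  have hchain : S.chain disc ξ t (K + 1) ω =
      (S.arrivalTime K ω, fun i => ServerState.ofList (S.jobs disc ξ ω K i)) := by
    rw [chain_succ, chain_eq S disc ξ t ht ω K hlt, jumpStep, if_pos (hsum K hlt)]
    simp only [hT]
    rw [if_neg (not_le.2 hKt)]
  have hKn : K + 1 ≤ n := by
    by_contra hcon
    have hle : ∀ m < n, S.arrivalTime m ω ≤ t := fun m hm => hlt m (by omega)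
    rw [chain_eq S disc ξ t ht ω n hle] at h
    exact absurd h (not_lt.2 (hsum n hle))
  rw [chain_frozen (ρ := routeJob disc) (t := t) (σ := S.chain disc ξ t) (M := S.mark)
    (fun n ω => rfl) (by rw [hchain]; exact hKt) hKn, hchain, terminalProportion]
  congr 1
  funext i
  rw [queueLength, hnum, disc.numJobs_get]

lemma ae_mark_pos [IsProbabilityMeasure P] [IsProbabilityMeasure G] (hDN : D < N)
    (hlam : 0 < lam) : ∀ᵐ ω ∂P, ∀ n, 0 < (S.mark n ω).1 := by
  have hN : (0 : ℝ) < N := by exact_mod_cast (Nat.zero_le D).trans_lt hDN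
  have := isProbabilityMeasure_expMeasure (mul_pos hlam hN)
  have := isProbabilityMeasure_uniformOn_injective hDN
  refine ae_all_iff.2 fun n => ?_
  have h1 : ∀ᵐ τ ∂(expMeasure (lam * N)), 0 < τ := by
    change ∀ᵐ τ ∂(volume.withDensity (gammaPDF 1 (lam * N))), 0 < τ
    rw [ae_withDensity_iff (by exact (measurable_gammaPDFReal 1 _).ennreal_ofReal)]
    have : ∀ᵐ τ : ℝ ∂volume, τ ≠ 0 := by simp [ae_iff]
    filter_upwards [this] with τ hτ hne
    by_contra hcon
    exact hne (exponentialPDF_of_neg (lt_of_le_of_ne (not_lt.1 hcon) hτ))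
  have h2 : ∀ᵐ m ∂(P.map (S.mark n)), 0 < m.1 := by
    rw [S.map_mark n]
    exact Measure.quasiMeasurePreserving_fst.ae h1
  exact ae_of_ae_map (S.measurable_mark n).aemeasurable h2

end JSQInput

/-! ### From variances to covariances, and conclusion. -/

/-- Nonnegativity of Var(X + Y) and Var(X - Y) gives 2|Cov(X,Y)| ≤ Var X + Var Y ≤ 2B. -/
lemma abs_covariance_le_of_moments {Ω : Type*} [MeasurableSpace Ω] {P : Measure Ω}
    [IsProbabilityMeasure P] {X Y : Ω → ℝ} (hX : Measurable X) (hY : Measurable Y)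
    (hX1 : ∀ ω, |X ω| ≤ 1) (hY1 : ∀ ω, |Y ω| ≤ 1) {B : ℝ}
    (hXB : ∫ ω, X ω ^ 2 ∂P ≤ (∫ ω, X ω ∂P) ^ 2 + B)
    (hYB : ∫ ω, Y ω ^ 2 ∂P ≤ (∫ ω, Y ω ∂P) ^ 2 + B) :
    |(∫ ω, X ω * Y ω ∂P) - (∫ ω, X ω ∂P) * ∫ ω, Y ω ∂P| ≤ B := by
  have hX2 : MemLp X 2 P := MemLp.of_bound hX.aestronglyMeasurable 1 (ae_of_all _ hX1)
  have hY2 : MemLp Y 2 P := MemLp.of_bound hY.aestronglyMeasurable 1 (ae_of_all _ hY1)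
  have hadd := variance_add hX2 hY2
  have hsub := variance_sub hX2 hY2
  have h1 := variance_nonneg (X + Y) P
  have h2 := variance_nonneg (X - Y) P
  have hvX := variance_eq_sub hX2
  have hvY := variance_eq_sub hY2
  have hcov := covariance_eq_sub hX2 hY2
  simp only [Pi.pow_apply, Pi.mul_apply] at hvX hvY hcov
  rw [← hcov, abs_le]
  constructor <;> linarith

namespace JSQInput

variable {Ω : Type*} [MeasurableSpace Ω] {P : Measure Ω} {N D : ℕ} {lam : ℝ} {G : Measure ℝ}

/-- The variance is split into that of the initial value V(0, ·), a function of independent data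
with bounded differences, and that of the martingale jumps at arrivals. -/
theorem integral_empiricalMeasure_sq_le [IsProbabilityMeasure P] [IsProbabilityMeasure G]
    (hD : 1 ≤ D) (hDN : D < N) (hlam : 0 < lam) (S : JSQInput P N D lam G)
    (disc : WorkConservingDiscipline) (ξ : Fin N → ℕ) {t : ℝ} (ht : 0 ≤ t) (k : ℕ) :
    ∫ ω, empiricalMeasure (S.queueLength disc ξ t ω) k ^ 2 ∂P ≤
      (∫ ω, empiricalMeasure (S.queueLength disc ξ t ω) k ∂P) ^ 2 + chaosBound N D lam t := by
  have hN1 : (1 : ℝ) < N := by exact_mod_cast hD.trans_lt hDN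
  have hN0 : (0 : ℝ) < N := by linarith
  have hD' : (1 : ℝ) ≤ D := by exact_mod_cast hD
  have hND : (0 : ℝ) < N - D := by rw [sub_pos]; exact_mod_cast hDN
  have hθ : 0 < lam * N := by positivity
  set c : ℝ := 2 ^ (D - 1) * lam * D * N / ((N : ℝ) - D) with hcdef
  have hc0 : 0 < c := by positivity
  -- The exponent in `uN` is larger than the coupling requires: D - 1 ≤ 2^(D-1) and N - D ≤ N - 1.
  have hc : lam * N * (D * (D - 1)) ≤ c * (N - 1) := by
    have h1 : (D : ℝ) - 1 ≤ 2 ^ (D - 1) := by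
      have h2 : D - 1 < 2 ^ (D - 1) := Nat.lt_two_pow_self
      have h3 : ((D - 1 : ℕ) : ℝ) ≤ 2 ^ (D - 1) := by exact_mod_cast h2.le
      rwa [Nat.cast_sub hD, Nat.cast_one] at h3
    calc lam * N * (D * (D - 1)) = (D - 1) * lam * D * N / (N - D) * (N - D) := by
          field_simp
      _ ≤ 2 ^ (D - 1) * lam * D * N / (N - D) * (N - 1) := by gcongr
  have := isProbabilityMeasure_expMeasure hθ
  have := isProbabilityMeasure_uniformOn_injective hDN
  have : IsProbabilityMeasure (volume.restrict (Set.Icc (0 : ℝ) 1)) := ⟨by simp⟩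
  set ν' := G.prod (volume.restrict (Set.Icc (0 : ℝ) 1))
  set ν := (uniformOn {e : Fin D → Fin N | Function.Injective e}).prod ν' with hν
  have hρ := measurable_routeJob (N := N) (D := D) disc
  have hF := measurable_terminalProportion (N := N) disc t k
  obtain ⟨V, hVm, hVC, hVt, hfix, hlim⟩ := exists_jump_value (ν := ν) hρ hθ t hF (C := 1)
    fun q => abs_empiricalMeasure_le _ k
  have hlip : ∀ s ≤ t, ∀ q q', |V (s, q) - V (s, q')| ≤
      logistic N c (differing q q').card (t - s) / N := fun s hs q q' =>
    le_of_tendsto' ((hlim (s, q)).sub (hlim (s, q'))).abs fun n =>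
      abs_sub_value_le_logistic hD hDN hlam hc disc t k n hs q q'
  have hlip1 : ∀ s ≤ t, ∀ q q', (differing q q').card ≤ 1 → |V (s, q) - V (s, q')| ≤
      logistic N c 1 (t - s) / N := fun s hs q q' hq =>
    (hlip s hs q q').trans (div_le_div_of_nonneg_right (logistic_mono hN0 hc0.le zero_le_one
      (Nat.cast_nonneg _) (by exact_mod_cast hq) (sub_nonneg.2 hs)) hN0.le)
  have hX : ∀ᵐ ω ∂P, ∀ n, t < (S.chain disc ξ t n ω).1 →
      terminalProportion disc t k (S.chain disc ξ t n ω).2 =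
        empiricalMeasure (S.queueLength disc ξ t ω) k := by
    filter_upwards [S.ae_mark_pos hDN hlam] with ω hω n hn
    exact S.chain_terminal disc ξ t ht hω hn k
  have hA : Measurable fun ω i => S.initial i ω :=
    measurable_pi_lambda _ fun i => S.measurable_initial i
  have hind := fun n => indepFun_chain (t := t) (σ := S.chain disc ξ t) hρ hA S.measurable_mark
    (fun n ω => rfl)
    ⟨fun x => (0, initialState ξ x), measurable_const.prodMk (measurable_initialState ξ),
      fun ω => rfl⟩ S.iIndepFun_mark S.indepFun_mark_initial.symm n
  -- With this ψ, ψ'/θ equals (y/N)² for the logistic flow y from 1 and θ = λN, which is exactly the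
  -- bound on the squared jump caused by changing one server.
  obtain ⟨hmean, hsq⟩ := chain_terminal_moments (P := P) (ν := ν) hρ hθ ht hVm hVC hVt hfix
    (ψ := fun τ => lam / c * logisticEnergy N c τ)
    (ψ' := fun τ => lam / c * (c / N * logistic N c 1 τ ^ 2))
    (fun τ => (hasDerivAt_logisticEnergy hN1.le τ).const_mul _)
    (((continuous_logistic_one hN1.le).pow 2).const_mul _ |>.const_mul _)
    (by simp [logisticEnergy_zero hN1.le])
    (fun τ hτ => mul_nonneg (by positivity) (logisticEnergy_nonneg hN1.le hc0.le hτ))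
    (fun q r z hr => by
      have h1 := hlip1 r hr _ _ (card_differing_routeJob_self_le disc q r z)
      have h2 := pow_le_pow_left₀ (abs_nonneg _) h1 2
      rw [sq_abs] at h2
      refine h2.trans_eq ?_
      field_simp)
    (S.measurable_chain disc ξ t) S.measurable_mark (fun n ω => rfl) hind S.map_mark
    (fun ω => rfl) hX
  have hlawA : P.map (fun ω i => S.initial i ω) = Measure.pi fun i => P.map (S.initial i) :=
    S.iIndepFun_initial.map_fun_eq_pi_map fun i => (S.measurable_initial i).aemeasurable
  have : ∀ i, IsProbabilityMeasure (P.map (S.initial i)) := fun i =>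
    Measure.isProbabilityMeasure_map (S.measurable_initial i).aemeasurable
  have hgm : Measurable fun x => V (0, initialState ξ x) :=
    hVm.comp (measurable_const.prodMk (measurable_initialState ξ))
  -- Resampling the initial data of one server changes at most one state, hence the differences are
  -- bounded by y(t)/N.
  have hinit := integral_pi_sq_le_of_bounded_differences (fun i => P.map (S.initial i)) hgm
    (fun x => hVC _) (b := logistic N c 1 t / N) fun x i y => by
      simpa using hlip1 0 ht _ _ (differing_initialState_update ξ x i y)
  rw [← hlawA, integral_map hA.aemeasurable (hgm.pow_const 2).aestronglyMeasurable,
    integral_map hA.aemeasurable hgm.aestronglyMeasurable] at hinit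
  have hbound := logistic_sq_add_energy_le_chaosBound hD hDN hlam ht hcdef
  have hdiv : (N : ℝ) * (logistic N c 1 t / N) ^ 2 = logistic N c 1 t ^ 2 / N := by field_simp
  rw [hdiv] at hinit
  rw [hmean]
  refine hsq.trans ?_
  change (∫ ω, V (0, initialState ξ fun i => S.initial i ω) ^ 2 ∂P) + _ ≤
    (∫ ω, V (0, initialState ξ fun i => S.initial i ω) ∂P) ^ 2 + _
  linarith

end JSQInput

theorem proposition2p1 {Ω : Type*} [MeasurableSpace Ω] (P : Measure Ω) [IsProbabilityMeasure P]
    (N D : ℕ) (hD : 1 ≤ D) (hDN : D < N) (lam : ℝ) (hlam : 0 < lam)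
    (G : Measure ℝ) [IsProbabilityMeasure G] (hG : ∀ᵐ s ∂G, 0 < s)
    (disc : WorkConservingDiscipline) (S : JSQInput P N D lam G)
    (t : ℝ) (ht : 0 ≤ t) (k l : ℕ) :
    (∀ (ξ : Fin N → ℕ) (i : Fin N), Measurable fun ω => S.queueLength disc ξ t ω i) ∧
    (∀ ξ : Fin N → ℕ,
      |(∫ ω, empiricalMeasure (S.queueLength disc ξ t ω) k *
            empiricalMeasure (S.queueLength disc ξ t ω) l ∂P) -
          (∫ ω, empiricalMeasure (S.queueLength disc ξ t ω) k ∂P) *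
            ∫ ω, empiricalMeasure (S.queueLength disc ξ t ω) l ∂P|
        ≤ chaosBound N D lam t) ∧
    Tendsto (fun M : ℕ => chaosBound M D lam t) atTop (𝓝 0) := by
  refine ⟨fun ξ i => S.measurable_queueLength disc ξ t i, fun ξ => ?_,
    tendsto_chaosBound D lam t⟩
  have hm : ∀ k, Measurable fun ω => empiricalMeasure (S.queueLength disc ξ t ω) k := fun k =>
    (measurable_empiricalMeasure k).comp
      (measurable_pi_lambda _ fun i => S.measurable_queueLength disc ξ t i)
  exact abs_covariance_le_of_moments (hm k) (hm l) (fun ω => abs_empiricalMeasure_le _ k)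
    (fun ω => abs_empiricalMeasure_le _ l)
    (S.integral_empiricalMeasure_sq_le hD hDN hlam disc ξ ht k)
    (S.integral_empiricalMeasure_sq_le hD hDN hlam disc ξ ht l)
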